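/- Let $\mathbb K$ be a perfect field, let $S$ be a nonsingular projective surface that is rational over $\mathbb K$, and let $D\in\mathrm{Pic}(S)$ be an effective nef class with $D^2>0$. All surfaces below are nonsingular and projective, all maps and curves are defined over $\mathbb K$, and $K_T$ denotes the canonical class of a surface $T$. A class is effective if it contains an effective divisor, and $\dim(C)$ is the dimension of the projective space $|C|$ of effective divisors in the class $C$ ($-1$ if $|C|$ is empty). For an effective class $C$ on $T$, let $\phi_C:T\dashrightarrow\mathbb P^{\dim(C)}$ be the associated rational map. The number of moving components $\mathrm{nmc}(C)$ is $0$ if the image of $\phi_C$ is a point, the degree of the image if it is a curve, and $1$ if it is a surface; if $|C|$ is empty, put $\mathrm{nmc}(C)=0$. For an effective class $C$ on $T$, $\mathrm{level}(C)$ is the supremum in the extended reals of all $p/q$ with $p,q\in\mathbb Z$, $q>0$, such that $qC+pK_T$ is effective. If this supremum is attained, $\mathrm{keel}(C)$ is the supremum of all $\mathrm{nmc}(qC+pK_T)/q$ with $q>0$, $p/q=\mathrm{level}(C)$ and $qC+pK_T$ effective; otherwise $\mathrm{keel}(C)=0$. A prime divisor $E$ on $T$ is exceptional if $E^2=E\cdot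 K_T<0$. The surface $T$ is $C$-minimal if no exceptional $E$ satisfies $E\cdot C=0$. A $C$-minimalization of $T$ is a birational morphism $\mu:T\to T'$ such that $C=\mu^*\mu_*C$ and $T'$ is $\mu_*C$-minimal. An adjoint chain of $(S,D)$ is a chain $S\xrightarrow{\mu_0}S_0\xrightarrow{\mu_1}S_1\xrightarrow{\mu_2}\cdots$ with classes $D_i\in\mathrm{Pic}(S_i)$ such that $\mu_0$ is a $D$-minimalization and $D_0=(\mu_0)_*D$, and, with $K_i:=K_{S_i}$: if $D_i+K_i$ is not effective, the chain ends at $a:=i$; otherwise $\mu_{i+1}$ is a $(D_i+K_i)$-minimalization and $D_{i+1}=(\mu_{i+1})_*(D_i+K_i)$. If it never ends, $a:=\infty$. Then for every adjoint chain of $(S,D)$ and every integer $i$ with $0\le i\le a$, the class $D_i$ is effective and $$\mathrm{level}(D_i)=\mathrm{level}(D)-i,\qquad \mathrm{keel}(D_i)=\mathrm{keel}(D).$$ Moreover, for all integers $p,q$ with $q\ge 0$ and $p\ge qi$, $$\dim(qD+pK_S)=\dim(qD_i+(p-qi)K_i),\qquad \mathrm{nmc}(qD+pK_S)=\mathrm{nmc}(qD_i+(p-qi)K_i).$$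 -/

import Mathlib

universe u

open AlgebraicGeometry CategoryTheory

noncomputable section

namespace SurfaceAdjunction

/-! ### Nonsingular projective surfaces -/

/-- The grading of `k[x₀, …, xₙ]` by degree. -/
abbrev homGrading (k : Type u) [Field k] (n : ℕ) : ℕ → Submodule k (MvPolynomial (Fin (n + 1)) k) :=
  MvPolynomial.homogeneousSubmodule (Fin (n + 1)) k

instance (k : Type u) [Field k] (n : ℕ) : GradedAlgebra (homGrading k n) :=
  MvPolynomial.gradedAlgebra

/-- Projective space `ℙⁿ` over the field `k`. -/
abbrev projSpace (k : Type u) [Field k] (n : ℕ) : Scheme.{u} := Proj (homGrading k n)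

/-- The structure morphism `ℙⁿ ⟶ Spec k`. -/
def projSpaceStr (k : Type u) [Field k] (n : ℕ) : projSpace k n ⟶ Spec (CommRingCat.of k) :=
  Proj.toSpecZero (homGrading k n) ≫
    Spec.map (CommRingCat.ofHom (algebraMap k (homGrading k n 0)))

/-- A nonsingular projective surface over `k`: an integral scheme, smooth of relative dimension
two over `k`, which is a closed subscheme of some projective space over `k`.
(Over a perfect field nonsingular and smooth mean the same.) -/
structure Surface (k : Type u) [Field k] where
  scheme : Scheme.{u}
  str : scheme ⟶ Spec (CommRingCat.of k)
  isIntegral : IsIntegral scheme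
  smooth : SmoothOfRelativeDimension 2 str
  projective : ∃ (n : ℕ) (i : scheme ⟶ projSpace k n),
    IsClosedImmersion i ∧ i ≫ projSpaceStr k n = str

variable {k : Type u} [Field k]

instance (S : Surface k) : IsIntegral S.scheme := S.isIntegral

instance (S : Surface k) : SmoothOfRelativeDimension 2 S.str := S.smooth

instance (S : Surface k) : IsLocallyNoetherian S.scheme := by
  have : Smooth S.str := SmoothOfRelativeDimension.smooth 2 S.str
  exact LocallyOfFiniteType.isLocallyNoetherian S.str

/-- `S` is rational over `k`: birational over `k` to an affine space over `k`. -/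
def Surface.IsRational (S : Surface k) : Prop := Scheme.IsRationalOver S.str

/-- The local ring of the surface `S` at the point `x`. -/
abbrev localRing (S : Surface k) (x : S.scheme) : CommRingCat.{u} := S.scheme.presheaf.stalk x

/-- The function field of the surface `S`. -/
abbrev funField (S : Surface k) : CommRingCat.{u} := S.scheme.functionField

/-- The local rings of `S` (the function field being one of them) are `k`-algebras through the
structure morphism. -/
instance (S : Surface k) (x : S.scheme) : Algebra k (S.scheme.presheaf.stalk x) :=
  ((Scheme.ΓSpecIso (CommRingCat.of k)).inv ≫ S.str.appTop ≫
    S.scheme.presheaf.germ ⊤ x trivial).hom.toAlgebra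

/-! ### Divisors and divisor classes -/

/-- A prime divisor, i.e. an irreducible curve on `S` over `k`, is given by its generic point,
which is a point of codimension one. -/
abbrev PrimeDivisor (S : Surface k) : Type u := {x : S.scheme // Order.coheight x = 1}

/-- The group of divisors of `S`. -/
abbrev Div (S : Surface k) : Type u := PrimeDivisor S →₀ ℤ

lemma ord_one' (S : Surface k) (x : S.scheme) :
    Scheme.ord (1 : funField S) x = 0 := by
  have h := Scheme.ord_mul (x := x) (one_ne_zero (α := funField S)) one_ne_zero
  rw [mul_one] at h
  omega

lemma ord_inv' (S : Surface k) (x : S.scheme) {f : funField S} (hf : f ≠ 0) :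
    Scheme.ord (f⁻¹) x = - Scheme.ord f x := by
  have h := Scheme.ord_mul (x := x) hf (inv_ne_zero hf)
  rw [mul_inv_cancel₀ hf, ord_one'] at h
  omega

/-- The group of principal divisors: the divisors of nonzero rational functions. -/
def principalDivisors (S : Surface k) : AddSubgroup (Div S) where
  carrier := {M | ∃ f : funField S, f ≠ 0 ∧ ∀ x : PrimeDivisor S, M x = Scheme.ord f x.1}
  zero_mem' := ⟨1, one_ne_zero, fun x => by simp [ord_one']⟩
  add_mem' := by
    rintro M N ⟨f, hf, hM⟩ ⟨g, hg, hN⟩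
    exact ⟨f * g, mul_ne_zero hf hg, fun x => by
      rw [Scheme.ord_mul hf hg, Finsupp.add_apply, hM, hN]⟩
  neg_mem' := by
    rintro M ⟨f, hf, hM⟩
    exact ⟨f⁻¹, inv_ne_zero hf, fun x => by rw [ord_inv' S x.1 hf, Finsupp.neg_apply, hM]⟩

/-- The group of divisor classes modulo linear equivalence. -/
abbrev Pic (S : Surface k) : Type u := Div S ⧸ principalDivisors S

/-- The class of a divisor. -/
def cls {S : Surface k} (M : Div S) : Pic S := QuotientAddGroup.mk M

/-- A class is effective iff it contains an effective divisor. -/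
def IsEffective {S : Surface k} (C : Pic S) : Prop := ∃ M : Div S, 0 ≤ M ∧ cls M = C

/-! ### Complete linear systems -/

/-- The Riemann-Roch space `L(M)` of the rational functions `f` with `f = 0` or `div f + M ≥ 0`.
These functions form a `k`-subspace already, so that taking the span adds nothing.
The complete linear system `|M|` is the projective space of lines in `L(M)`. -/
def rrSpace {S : Surface k} (M : Div S) : Submodule k (funField S) :=
  Submodule.span k {f | f ≠ 0 ∧ ∀ x : PrimeDivisor S, 0 ≤ Scheme.ord f x.1 + M x}

/-- The dimension of the complete linear system `|C|` as a projective space (`-1` if it is empty),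
computed with a representative of the class `C`. -/
def dim {S : Surface k} (C : Pic S) : ℤ := (Module.finrank k (rrSpace C.out) : ℤ) - 1

/-- The Hilbert function of the image `X` of the rational map defined by a basis `f₀, …, fₙ` of a
finite dimensional space `L` of rational functions. The part of degree `m` of the homogeneous
coordinate ring `k[x₀, …, xₙ] / I(X)` is isomorphic to the space spanned by all values of the
monomials of degree `m` at `(f₀, …, fₙ)`, and this is the `m`-th power of `L`. -/
def hilbertFun {S : Surface k} (L : Submodule k (funField S)) (m : ℕ) : ℕ :=
  Module.finrank k ↥(L ^ m)

open Classical in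
/-- The degree of the image of the rational map defined by `L`, if that image is a curve: the
leading coefficient of the Hilbert polynomial `e * m + c`. -/
def curveDegree {S : Surface k} (L : Submodule k (funField S)) : ℕ :=
  if h : ∃ (e : ℕ), ∃ c : ℤ, ∀ᶠ m : ℕ in Filter.atTop, (hilbertFun L m : ℤ) = e * m + c
  then h.choose else 0

/-- The function field of the image of the rational map defined by `L`: it is generated
over `k` by the quotients of elements of `L`. -/
def imageField {S : Surface k} (L : Submodule k (funField S)) :
    IntermediateField k (funField S) :=
  IntermediateField.adjoin k {h | ∃ f ∈ L, ∃ g ∈ L, g ≠ 0 ∧ h = f / g}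

/-- The dimension of the image of the rational map defined by `L`. -/
def imageDim {S : Surface k} (L : Submodule k (funField S)) : Cardinal :=
  Algebra.trdeg k (imageField L)

open Classical in
/-- The number of moving components of an effective class `C`: it is `0` if the image of the
rational map associated to `|C|` is a point, the degree of the image if the image is a curve,
and `1` if the image is a surface. It is computed with a representative of `C`. -/
def nmc {S : Surface k} (C : Pic S) : ℕ :=
  if imageDim (rrSpace C.out) = 0 then 0
  else if imageDim (rrSpace C.out) = 1 then curveDegree (rrSpace C.out)
  else 1

/-! ### The canonical class -/

/-- `M` is the divisor of some nonzero rational `2`-form `ω`. At a prime divisor `x` we write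
`ω = g • (du ∧ dv)` where `du, dv` generate the module of differentials of the local ring at `x`
(which is free of rank two); then the multiplicity of `x` is the order of `g` at `x`. -/
def IsCanonicalDivisor {S : Surface k} (M : Div S) : Prop :=
  ∃ ω : ⋀[funField S]^2 (Ω[funField S⁄k]), ω ≠ 0 ∧
    ∀ x : PrimeDivisor S, ∃ (u v : localRing S x.1) (g : funField S),
      Submodule.span (localRing S x.1)
        {KaehlerDifferential.D k (localRing S x.1) u,
          KaehlerDifferential.D k (localRing S x.1) v} = ⊤ ∧
      ω = g • exteriorPower.ιMulti (funField S) 2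
        ![KaehlerDifferential.D k (funField S) (algebraMap (localRing S x.1) (funField S) u),
          KaehlerDifferential.D k (funField S) (algebraMap (localRing S x.1) (funField S) v)] ∧
      M x = Scheme.ord g x.1

open Classical in
/-- The canonical class of `S`: the class of the divisor of any nonzero rational `2`-form. -/
def canonicalClass (S : Surface k) : Pic S :=
  if h : ∃ M : Div S, IsCanonicalDivisor M then cls h.choose else 0

/-! ### The intersection product -/

/-- The ideal of the effective divisor `M` in the local ring at the point `p`. -/
def localIdeal {S : Surface k} (M : Div S) (p : S.scheme) : Ideal (localRing S p) :=
  Ideal.span {g | g ≠ 0 ∧ ∀ x : PrimeDivisor S, x.1 ⤳ p →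
    M x ≤ Scheme.ord (algebraMap (localRing S p) (funField S) g) x.1}

/-- The intersection multiplicity over `k` at the point `p` of two effective divisors without
common component. -/
def localMult {S : Surface k} (M N : Div S) (p : S.scheme) : ℕ :=
  Module.finrank k (localRing S p ⧸ (localIdeal M p ⊔ localIdeal N p))

/-- The characterization of the intersection product: a symmetric bi-additive form on classes
such that the product of the classes of two effective divisors without common component is the
number of their common points, counted with multiplicity. -/
def IsIntersectionPairing (S : Surface k) (B : Pic S →+ Pic S →+ ℤ) : Prop :=
  (∀ C C' : Pic S, B C C' = B C' C) ∧
  ∀ M N : Div S, 0 ≤ M → 0 ≤ N → (∀ x, M x = 0 ∨ N x = 0) →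
    B (cls M) (cls N) = ((∑ᶠ p : S.scheme, localMult M N p : ℕ) : ℤ)

open Classical in
/-- The intersection product, the unique pairing with the properties above. -/
def intersectionPairing (S : Surface k) : Pic S →+ Pic S →+ ℤ :=
  if h : ∃ B, IsIntersectionPairing S B then h.choose else 0

/-- The intersection number of two classes. -/
def inter {S : Surface k} (C C' : Pic S) : ℤ := intersectionPairing S C C'

/-- A class is nef iff its intersection number with every effective class is nonnegative. -/
def IsNef {S : Surface k} (D : Pic S) : Prop := ∀ C : Pic S, IsEffective C → 0 ≤ inter D C

/-- The class of a prime divisor. -/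
def primeClass {S : Surface k} (E : PrimeDivisor S) : Pic S := cls (Finsupp.single E 1)

/-- A prime divisor `E` is exceptional iff `E² = E·K < 0`. -/
def IsExceptional {S : Surface k} (E : PrimeDivisor S) : Prop :=
  inter (primeClass E) (primeClass E) = inter (primeClass E) (canonicalClass S) ∧
    inter (primeClass E) (primeClass E) < 0

/-- `S` is `D`-minimal iff it has no exceptional divisor orthogonal to `D`. -/
def IsMinimal {S : Surface k} (D : Pic S) : Prop :=
  ∀ E : PrimeDivisor S, IsExceptional E → inter D (primeClass E) ≠ 0

/-! ### Birational morphisms -/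

/-- A morphism over `k` is birational iff it restricts to an isomorphism between dense open
subschemes. -/
def IsBirationalMorphism {S T : Surface k} (μ : S.scheme ⟶ T.scheme) : Prop :=
  μ ≫ T.str = S.str ∧
    ∃ e : Scheme.PartialIso S.scheme T.scheme,
      e.iso.hom ≫ e.target.ι = e.source.ι ≫ μ

open Classical in
/-- The pushforward of divisors along a birational morphism: a prime divisor is mapped to its
image if that is a curve, and to `0` otherwise. (The residue degrees are `1`.) -/
def pushDiv {S T : Surface k} (μ : S.scheme ⟶ T.scheme) (M : Div S) : Div T :=
  M.sum fun x n =>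
    if h : Order.coheight (μ.base x.1) = 1 then Finsupp.single ⟨μ.base x.1, h⟩ n else 0

/-- The pushforward of classes along a birational morphism, computed with a representative. -/
def pushClass {S T : Surface k} (μ : S.scheme ⟶ T.scheme) (C : Pic S) : Pic T :=
  cls (pushDiv μ C.out)

/-- `N` is the pullback of the divisor `M` along the birational morphism `μ`: at a prime
divisor `x` of `S`, the multiplicity of `N` is the order of the pullback of a local equation `a / b`
of `M` at the point `μ x`. -/
def IsPullback {S T : Surface k} (μ : S.scheme ⟶ T.scheme) (M : Div T) (N : Div S) : Prop :=
  ∀ x : PrimeDivisor S, ∃ (a b : localRing T (μ.base x.1)) (U : T.scheme.Opens),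
    a ≠ 0 ∧ b ≠ 0 ∧ μ.base x.1 ∈ U ∧
    (∀ z : PrimeDivisor T, z.1 ∈ U →
      M z = Scheme.ord (algebraMap (localRing T (μ.base x.1)) (funField T) a) z.1
        - Scheme.ord (algebraMap (localRing T (μ.base x.1)) (funField T) b) z.1) ∧
    N x = Scheme.ord (algebraMap (localRing S x.1) (funField S) ((μ.stalkMap x.1).hom a)) x.1
        - Scheme.ord (algebraMap (localRing S x.1) (funField S) ((μ.stalkMap x.1).hom b)) x.1

/-- The class `C` is the pullback of the class `B` along `μ`. -/
def IsPullbackClass {S T : Surface k} (μ : S.scheme ⟶ T.scheme) (B : Pic T) (C : Pic S) : Prop :=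
  ∃ (M : Div T) (N : Div S), cls M = B ∧ cls N = C ∧ IsPullback μ M N

/-- A `D`-minimalization: a birational morphism `μ : S ⟶ T` with `D = μ^* μ_* D` such that `T` is
`μ_* D`-minimal. -/
structure IsMinimalization {S T : Surface k} (D : Pic S) (μ : S.scheme ⟶ T.scheme) : Prop where
  birational : IsBirationalMorphism μ
  pullback_push : IsPullbackClass μ (pushClass μ D) D
  minimal : IsMinimal (pushClass μ D)

/-! ### Level and keel -/

/-- The class `q D + p K`. -/
def adj {S : Surface k} (D : Pic S) (q p : ℤ) : Pic S := q • D + p • canonicalClass S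

/-- The level of an effective class `D`: the supremum (in the extended real numbers) of all
`p / q` with `q > 0` such that `q D + p K` is effective. -/
def level {S : Surface k} (D : Pic S) : EReal :=
  sSup {r : EReal | ∃ p q : ℤ, 0 < q ∧ IsEffective (adj D q p) ∧
    r = (((p : ℝ) / (q : ℝ) : ℝ) : EReal)}

/-- `p / q` with `q > 0` is equal to the level of `D`, and `q D + p K` is effective. -/
def AttainsLevel {S : Surface k} (D : Pic S) (p q : ℤ) : Prop :=
  0 < q ∧ IsEffective (adj D q p) ∧ (((p : ℝ) / (q : ℝ) : ℝ) : EReal) = level D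

open Classical in
/-- The keel of an effective class `D`: the supremum of all `nmc (q D + p K) / q` where `p / q` is
the level of `D`, if the supremum in the definition of the level is assumed; otherwise `0`. -/
def keel {S : Surface k} (D : Pic S) : EReal :=
  if ∃ p q : ℤ, AttainsLevel D p q then
    sSup {r : EReal | ∃ p q : ℤ, AttainsLevel D p q ∧
      r = (((nmc (adj D q p) : ℝ) / (q : ℝ) : ℝ) : EReal)}
  else 0

/-! ### The adjoint chain -/

/-- An adjoint chain of `(S, D)`:
`S ⟶ S₀ ⟶ S₁ ⟶ ⋯` with classes `Dᵢ` on `Sᵢ`, where `length` (possibly `∞`) is the index of the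
last surface. The data with an index beyond the last surface are meaningless. -/
structure AdjointChain (S : Surface k) (D : Pic S) where
  /-- The index `a` of the last surface. -/
  length : ℕ∞
  /-- The surface `Sᵢ`. -/
  surf : ℕ → Surface k
  /-- The class `Dᵢ`. -/
  div : ∀ i, Pic (surf i)
  /-- The map `μ₀ : S ⟶ S₀`. -/
  map₀ : S.scheme ⟶ (surf 0).scheme
  /-- The map `μᵢ₊₁ : Sᵢ ⟶ Sᵢ₊₁`. -/
  map : ∀ i, (surf i).scheme ⟶ (surf (i + 1)).scheme
  minimalization₀ : IsMinimalization D map₀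
  div_zero : div 0 = pushClass map₀ D
  effective : ∀ i : ℕ, (i : ℕ∞) < length → IsEffective (div i + canonicalClass (surf i))
  minimalization : ∀ i : ℕ, (i : ℕ∞) < length →
    IsMinimalization (div i + canonicalClass (surf i)) (map i)
  div_succ : ∀ i : ℕ, (i : ℕ∞) < length →
    div (i + 1) = pushClass (map i) (div i + canonicalClass (surf i))
  not_effective : ∀ i : ℕ, (i : ℕ∞) = length → ¬ IsEffective (div i + canonicalClass (surf i))

end SurfaceAdjunction

end

noncomputable section

namespace SurfaceAdjunction

/-! ### Commutative algebra -/

section CommutativeAlgebra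

/-! The heart is a comparison along one birational morphism `μ : S ⟶ T`. Let the class `C` be the
pullback of `B`. Then for `p ≥ 0` the systems of `q C + p K_S` and `q B + p K_T` coincide under the
isomorphism of function fields (`sameSystem_adj`). The divisor of a pulled back `2`-form is the
pullback of the divisor of the form plus an effective divisor supported on contracted curves
(`exists_canonicalDivisor_comparison`): Jacobian determinants are regular, and they are units where
the local rings agree.

Let `f` be a section on `T`. Near `μ x`, the product of `f` with a local equation of `q M + p A` has
no poles at prime divisors. By algebraic Hartogs (`mem_range_of_forall_ord_nonneg`) it is regular,
hence so is its pullback at `x`, and the effective excess only relaxes the condition. Conversely, by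
the valuative criterion every prime divisor of `T` is the image of one of `S` with the same local
ring (`IsBirationalMorphism.exists_primeDivisor`), so a section on `S` satisfies all the conditions
on `T`.

Effectiveness, `dim` and `nmc` depend only on the space of sections up to this isomorphism and a
scalar factor. As `q (D + K) + p K = q D + (p + q) K`, induction along the chain yields
`AdjointShift`, and the statements on level and keel follow formally by shifting `p / q`. -/

open TensorProduct in
/-- A domain which is étale over an integrally closed domain is integrally closed. -/
lemma isIntegrallyClosed_of_etale (P A : Type*) [CommRing P] [IsDomain P] [IsIntegrallyClosed P]
    [CommRing A] [IsDomain A] [Algebra P A] [Algebra.Etale P A] : IsIntegrallyClosed A := by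
  let L := FractionRing P
  let B := A ⊗[P] L
  have : Module.Flat P A := inferInstance
  have hloc : IsLocalization (Algebra.algebraMapSubmonoid A (nonZeroDivisors P)) B :=
    inferInstance
  have hle : Algebra.algebraMapSubmonoid A (nonZeroDivisors P) ≤ nonZeroDivisors A := by
    rintro _ ⟨p, hp, rfl⟩
    refine mem_nonZeroDivisors_of_ne_zero fun h => nonZeroDivisors.ne_zero hp ?_
    exact FaithfulSMul.algebraMap_injective P A (by rw [h, map_zero])
  have hdom : IsDomain B := IsLocalization.isDomain_of_le_nonZeroDivisors B hle
  let : Algebra L B := Algebra.TensorProduct.rightAlgebra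
  have hL : Algebra.Etale L (L ⊗[P] A) := inferInstance
  have hfin : Module.Finite L (L ⊗[P] A) := Algebra.FormallyUnramified.finite_of_free L (L ⊗[P] A)
  let e : B ≃+* L ⊗[P] A := (Algebra.TensorProduct.comm P A L).toRingEquiv
  have hdom' : IsDomain (L ⊗[P] A) :=
    Function.Injective.isDomain e.symm.toRingHom e.symm.injective
  -- `B` is a domain and finite over the field `L`, so it is a field; it serves as the fraction
  -- field of `A`.
  have hfield : IsField B :=
    e.toMulEquiv.isField (isField_of_isIntegral_of_isField' (R := L) (Field.toIsField L))
  let := hfield.toField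
  have hinj : Function.Injective (algebraMap A B) := IsLocalization.injective B hle
  have : FaithfulSMul A B := (faithfulSMul_iff_algebraMap_injective A B).2 hinj
  have hfrac : IsFractionRing A B := by
    refine IsFractionRing.of_field A B fun z => ?_
    obtain ⟨a, s, rfl⟩ := IsLocalization.exists_mk'_eq
      (Algebra.algebraMapSubmonoid A (nonZeroDivisors P)) z
    refine ⟨a, s, ?_⟩
    have hs : algebraMap A B s ≠ 0 := fun h =>
      nonZeroDivisors.ne_zero (hle s.2) (hinj (by rw [h, map_zero]))
    rw [eq_div_iff hs, IsLocalization.mk'_spec]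
  refine (isIntegrallyClosed_iff B).2 fun {x} hx => ?_
  -- Integral closure commutes with smooth base change: an element of `B` integral over `A` comes
  -- from `A ⊗ integralClosure P L`. Since `P` is integrally closed, such elements already come from
  -- `A`.
  obtain ⟨t, ht⟩ := (toIntegralClosure_bijective_of_smooth (R := P) (S := A) (B := L)).2 ⟨x, hx⟩
  have key : ∀ t : A ⊗[P] integralClosure P L, ∃ y : A,
      algebraMap A B y = (toIntegralClosure P A L t : B) := by
    intro t
    induction t with
    | zero => exact ⟨0, by simp⟩
    | add a b ha hb =>
      obtain ⟨y, hy⟩ := ha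
      obtain ⟨z, hz⟩ := hb
      exact ⟨y + z, by rw [map_add, map_add, hy, hz]; rfl⟩
    | tmul a c =>
      obtain ⟨p, hp⟩ := (isIntegrallyClosed_iff L).1 ‹IsIntegrallyClosed P› c.2
      refine ⟨p • a, ?_⟩
      change (p • a) ⊗ₜ[P] (1 : L) = a ⊗ₜ[P] (c : L)
      rw [← hp, Algebra.algebraMap_eq_smul_one, TensorProduct.smul_tmul]
  obtain ⟨y, hy⟩ := key t
  exact ⟨y, by rw [hy, ht]⟩

/-- A domain which is standard smooth over a field is integrally closed. -/
lemma isIntegrallyClosed_of_isStandardSmooth (k A : Type*) [Field k] [CommRing A] [IsDomain A]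
    [Algebra k A] (n : ℕ) [Algebra.IsStandardSmoothOfRelativeDimension n k A] :
    IsIntegrallyClosed A := by
  obtain ⟨g, hg⟩ := Algebra.IsStandardSmoothOfRelativeDimension.exists_etale_mvPolynomial n k A
  let := g.toRingHom.toAlgebra
  have : Algebra.Etale (MvPolynomial (Fin n) k) A := hg
  exact isIntegrallyClosed_of_etale (MvPolynomial (Fin n) k) A

/-- If a fraction does not belong to a Noetherian integrally closed domain, then it does not belong
to the localization at some prime ideal of height one. -/
lemma exists_height_one_of_notMem {R K : Type*} [CommRing R] [IsDomain R] [IsNoetherianRing R]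
    [IsIntegrallyClosed R] [Field K] [Algebra R K] [IsFractionRing R K] {f : K}
    (hf : f ∉ (algebraMap R K).range) :
    ∃ P : Ideal R, P.IsPrime ∧ P.height = 1 ∧ ∀ s ∉ P, s • f ∉ (algebraMap R K).range := by
  let I : K → Ideal R := fun g =>
    (Subalgebra.toSubmodule (⊥ : Subalgebra R K)).comap (LinearMap.toSpanSingleton R K g)
  have hI : ∀ g r, r ∈ I g ↔ r • g ∈ (algebraMap R K).range := fun g r => Iff.rfl
  -- `I g` is the ideal of denominators of `g`. One that is maximal among those of the multiples of
  -- `f` outside `R` is prime.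
  obtain ⟨P, ⟨s₀, hs₀, rfl⟩, hmax⟩ := set_has_maximal_iff_noetherian.2 ‹IsNoetherianRing R›
    {J | ∃ s : R, s • f ∉ (algebraMap R K).range ∧ J = I (s • f)} ⟨_, 1, by rwa [one_smul], rfl⟩
  set g := s₀ • f with hg
  have hne : I g ≠ ⊤ := fun h => hs₀ (by
    have := (Ideal.eq_top_iff_one _).1 h
    rwa [hI, one_smul] at this)
  have hprime : (I g).IsPrime := by
    refine ⟨hne, fun {a b} hab => or_iff_not_imp_right.2 fun hb => ?_⟩
    have hle : I g ≤ I (b • g) := fun r hr => by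
      rw [hI] at hr ⊢
      obtain ⟨t, ht⟩ := hr
      exact ⟨b * t, by rw [map_mul, ht, smul_comm r b, Algebra.smul_def b (r • g)]⟩
    have heq : I g = I (b • g) := by
      by_contra h
      exact hmax _ ⟨b * s₀, by rwa [mul_smul], by rw [mul_smul]⟩ (lt_of_le_of_ne hle h)
    rw [heq, hI, smul_smul]
    exact hab
  refine ⟨I g, hprime, ?_, fun s hs hsf => hs ?_⟩
  · have hbot : I g ≠ ⊥ := by
      obtain ⟨a, b, hb, hab⟩ := IsFractionRing.div_surjective (A := R) g
      refine (Submodule.ne_bot_iff _).2 ⟨b, (hI _ _).2 ⟨a, ?_⟩, nonZeroDivisors.ne_zero hb⟩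
      have : algebraMap R K b ≠ 0 := by simpa using nonZeroDivisors.ne_zero hb
      rw [← hab, Algebra.smul_def, mul_div_cancel₀ _ this]
    -- Otherwise multiplication by `g` would map the nonzero finitely generated ideal `I g` into
    -- itself, and `g` would be integral over `R`. Up to the factor `u`, outside the ideal, `p₀`
    -- generates `I g`, so Krull's principal ideal theorem bounds the height.
    obtain ⟨p₀, hp₀, u, hu, hup⟩ : ∃ p₀ ∈ I g, ∃ u ∉ I g, algebraMap R K u = p₀ • g := by
      by_contra! h
      refine hs₀ ((isIntegrallyClosed_iff K).1 ‹_› ?_)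
      refine isIntegral_of_smul_mem_submodule (R := R) (A := K) (M := K)
        (N := Submodule.map (Algebra.linearMap R K) (I g)) ?_ ((IsNoetherian.noetherian _).map _) _ ?_
      · obtain ⟨b, hb, hb0⟩ := (Submodule.ne_bot_iff _).1 hbot
        refine (Submodule.ne_bot_iff _).2 ⟨_, ⟨b, hb, rfl⟩, by simpa using hb0⟩
      · rintro _ ⟨b, hb, rfl⟩
        obtain ⟨r, hr⟩ := (hI _ _).1 hb
        refine ⟨r, ?_, ?_⟩
        · by_contra hr'
          exact h b hb r hr' hr
        · rw [Algebra.linearMap_apply, hr, Algebra.linearMap_apply, Algebra.smul_def, smul_eq_mul,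
            mul_comm]
    refine le_antisymm ?_ ?_
    · refine Ideal.height_le_one_of_isPrincipal_of_mem_minimalPrimes (Ideal.span {p₀}) _
        ⟨⟨hprime, (Ideal.span_singleton_le_iff_mem _).2 hp₀⟩, ?_⟩
      rintro Q ⟨hQ, hpQ⟩ hQP p hp
      obtain ⟨r, hr⟩ := (hI _ _).1 hp
      have : u * p = r * p₀ := by
        apply FaithfulSMul.algebraMap_injective R K
        rw [map_mul, map_mul, hup, hr, Algebra.smul_def, Algebra.smul_def]
        ring
      have h2 : u * p ∈ Q := this ▸ Q.mul_mem_left _ (hpQ (Ideal.mem_span_singleton_self p₀))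
      exact (hQ.mem_or_mem h2).resolve_left fun h => hu (hQP h)
    · rw [Order.one_le_iff_ne_zero, Ne, Ideal.height_eq_zero_iff_eq_bot]
      exact hbot
  · rw [hI, hg, smul_comm]
    obtain ⟨t, ht⟩ := hsf
    exact ⟨s₀ * t, by rw [map_mul, ht, Algebra.smul_def s₀]⟩

end CommutativeAlgebra

/-! ### Orders of vanishing on normal schemes -/

section Orders

variable {X : Scheme.{u}} [IsIntegral X] [IsLocallyNoetherian X]

/-- The coheight of a point is the Krull dimension of its local ring, and a Noetherian normal local
domain of dimension one is a discrete valuation ring. -/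
lemma isDiscreteValuationRing_stalk {y : X} (hy : Order.coheight y = 1)
    [IsIntegrallyClosed (X.presheaf.stalk y)] :
    IsDiscreteValuationRing (X.presheaf.stalk y) := by
  have hdim : ringKrullDim (X.presheaf.stalk y) = 1 := by
    rw [ringKrullDim_stalk_eq_coheight, hy]; rfl
  have : Ring.KrullDimLE 1 (X.presheaf.stalk y) := krullDimLE_of_coheight_le hy.le
  have hf : ¬ IsField (X.presheaf.stalk y) := fun h => by
    have := ringKrullDim_eq_zero_of_isField h
    rw [hdim] at this
    exact one_ne_zero this
  have htfae := (IsDiscreteValuationRing.TFAE (X.presheaf.stalk y) hf).out 0 3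
  refine htfae.2 ⟨inferInstance,
    IsLocalRing.maximalIdeal (X.presheaf.stalk y),
    ⟨fun h => hf (IsLocalRing.isField_iff_maximalIdeal_eq.2 h), inferInstance⟩, ?_⟩
  rintro P ⟨hP, hP'⟩
  exact IsLocalRing.eq_maximalIdeal (hP'.isMaximal_of_ne_bot hP)

lemma ord_algebraMap_nonneg {x : X} {a : X.presheaf.stalk x} (ha : a ≠ 0) :
    0 ≤ Scheme.ord (algebraMap (X.presheaf.stalk x) X.functionField a) x := by
  by_cases hx : Order.coheight x = 1
  · have : Ring.KrullDimLE 1 (X.presheaf.stalk x) := krullDimLE_of_coheight_le hx.le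
    rw [Scheme.le_ord_iff hx (by simpa using ha)]
    exact Ring.ordFrac_ge_one_of_ne_zero ha
  -- Outside codimension one the order is zero by convention.
  · rw [Scheme.ord_eq_zero_of_coheight_neq_one hx]

lemma mem_range_of_ord_nonneg {y : X} (hy : Order.coheight y = 1)
    [IsIntegrallyClosed (X.presheaf.stalk y)] {f : X.functionField} (hf : f ≠ 0)
    (h : 0 ≤ Scheme.ord f y) : f ∈ (algebraMap (X.presheaf.stalk y) X.functionField).range := by
  have := isDiscreteValuationRing_stalk hy
  rw [Scheme.le_ord_iff hy hf] at h
  refine IsDiscreteValuationRing.exists_lift_of_le_one ?_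
  have h2 : (1 : WithZero (Multiplicative ℤ)) ≤ Ring.ordFrac (X.presheaf.stalk y) f := h
  -- The multiplicative valuation decreases as the order of vanishing grows, hence the inverse.
  rw [Ring.ordFrac_eq_valuation_inv] at h2
  rwa [one_le_inv₀] at h2
  rw [zero_lt_iff]
  simpa using hf

lemma exists_specializes_of_notMem_range {p : X} [IsIntegrallyClosed (X.presheaf.stalk p)]
    {f : X.functionField} (hf : f ∉ (algebraMap (X.presheaf.stalk p) X.functionField).range) :
    ∃ y : X, y ⤳ p ∧ Order.coheight y = 1 ∧
      f ∉ (algebraMap (X.presheaf.stalk y) X.functionField).range := by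
  obtain ⟨P, hP, hP1, hPf⟩ := exists_height_one_of_notMem hf
  obtain ⟨_, ⟨U, hU, rfl⟩, hpU, -⟩ := X.isBasis_affineOpens.exists_subset_of_mem_open
    (Set.mem_univ p) isOpen_univ
  have hU : IsAffineOpen U := hU
  have : Nonempty U := ⟨⟨p, hpU⟩⟩
  let _ := TopCat.Presheaf.algebra_section_stalk X.presheaf (⟨p, hpU⟩ : U)
  have hloc := hU.isLocalization_stalk ⟨p, hpU⟩
  have htower := functionField_isScalarTower X U ⟨p, hpU⟩
  -- The contraction of `P` to an affine chart is the generic point `y` of a prime divisor through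
  -- `p`, and the local ring at `y` is the localization of the chart at `Q`.
  let Q : Ideal Γ(X, U) := P.comap (algebraMap Γ(X, U) (X.presheaf.stalk p))
  have hQ : Q.IsPrime := hP.comap _
  let q : PrimeSpectrum Γ(X, U) := ⟨Q, hQ⟩
  let y : X := hU.fromSpec q
  have hyU : y ∈ U := by
    have : y ∈ Set.range hU.fromSpec := ⟨q, rfl⟩
    rwa [hU.range_fromSpec] at this
  let _ := TopCat.Presheaf.algebra_section_stalk X.presheaf (⟨y, hyU⟩ : U)
  have htower' := functionField_isScalarTower X U ⟨y, hyU⟩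
  have hq : hU.primeIdealOf ⟨y, hyU⟩ = q :=
    hU.fromSpec.isOpenEmbedding.injective (hU.fromSpec_primeIdealOf ⟨y, hyU⟩)
  have hloc' : IsLocalization.AtPrime (X.presheaf.stalk y) Q := by
    have := hU.isLocalization_stalk ⟨y, hyU⟩
    rwa [hq] at this
  refine ⟨y, ?_, ?_, ?_⟩
  · have h1 : q ⤳ hU.primeIdealOf ⟨p, hpU⟩ := by
      rw [← PrimeSpectrum.le_iff_specializes]
      intro a ha
      by_contra hap
      exact hP.ne_top (Ideal.eq_top_of_isUnit_mem _ ha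
        (IsLocalization.map_units _ (⟨a, hap⟩ : (hU.primeIdealOf ⟨p, hpU⟩).asIdeal.primeCompl)))
    have h2 := h1.map hU.fromSpec.continuous
    rwa [hU.fromSpec_primeIdealOf] at h2
  · have h1 := IsLocalization.AtPrime.ringKrullDim_eq_height Q (X.presheaf.stalk y)
    rw [ringKrullDim_stalk_eq_coheight,
      IsLocalization.height_under (hU.primeIdealOf ⟨p, hpU⟩).asIdeal.primeCompl, hP1] at h1
    exact_mod_cast h1
  · rintro ⟨g, rfl⟩
    obtain ⟨a, s, rfl⟩ := IsLocalization.exists_mk'_eq Q.primeCompl g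
    refine hPf (algebraMap _ _ s.1) s.2 ⟨algebraMap _ _ a, ?_⟩
    rw [← IsScalarTower.algebraMap_apply, Algebra.smul_def, ← IsScalarTower.algebraMap_apply,
      IsScalarTower.algebraMap_apply Γ(X, U) (X.presheaf.stalk y) X.functionField a,
      IsScalarTower.algebraMap_apply Γ(X, U) (X.presheaf.stalk y) X.functionField s.1, ← map_mul,
      IsLocalization.mk'_spec']

/-- Algebraic Hartogs: a rational function on a normal scheme which has no poles at the prime
divisors through a point is regular at that point. -/
lemma mem_range_of_forall_ord_nonneg [∀ y : X, IsIntegrallyClosed (X.presheaf.stalk y)] {p : X}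
    {f : X.functionField} (hf : f ≠ 0)
    (h : ∀ y : X, Order.coheight y = 1 → y ⤳ p → 0 ≤ Scheme.ord f y) :
    f ∈ (algebraMap (X.presheaf.stalk p) X.functionField).range := by
  by_contra hn
  obtain ⟨y, hyp, hy, hfy⟩ := exists_specializes_of_notMem_range hn
  exact hfy (mem_range_of_ord_nonneg hy hf (h y hy hyp))

lemma ord_eq_of_mul_isUnit {x : X} {f g : X.functionField} (hg : g ≠ 0)
    {a : X.presheaf.stalk x} (ha : IsUnit a)
    (h : f = algebraMap (X.presheaf.stalk x) X.functionField a * g) :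
    Scheme.ord f x = Scheme.ord g x := by
  rw [h, Scheme.ord_mul (by simpa using ha.ne_zero) hg]
  by_cases hx : Order.coheight x = 1
  · have : Ring.KrullDimLE 1 (X.presheaf.stalk x) := krullDimLE_of_coheight_le hx.le
    have h1 : Scheme.ord (algebraMap (X.presheaf.stalk x) X.functionField a) x = 0 := by
      rw [Scheme.ord_eq_iff hx (by simpa using ha.ne_zero)]
      exact Ring.ordFrac_of_isUnit ha
    rw [h1, zero_add]
  · simp [hx]

/-- A nonzero rational function has only finitely many zeros and poles. -/
lemma finite_ord_ne_zero [CompactSpace X] {f : X.functionField} (hf : f ≠ 0) :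
    {x : X | Order.coheight x = 1 ∧ Scheme.ord f x ≠ 0}.Finite := by
  -- On a nonempty open `U` the function is a unit. Every zero or pole of codimension one is
  -- therefore the generic point of one of the finitely many irreducible closed pieces of the
  -- complement.
  obtain ⟨U, -, f', hU, rfl, hu⟩ := exists_isUnit_germ_eq X f hf
  have : IsNoetherian X := {}
  obtain ⟨C, hC, hCcl, hCirr, hCU⟩ := TopologicalSpace.NoetherianSpace.exists_finite_set_isClosed_irreducible
    (U.isOpen.isClosed_compl)
  have hgen : ∀ W ∈ C, ∃ w : X, IsGenericPoint w W := fun W hW =>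
    QuasiSober.sober (hCirr W hW) (hCcl W hW)
  choose! w hw using hgen
  refine (hC.image w).subset ?_
  rintro x ⟨hx, hfx⟩
  have hxU : x ∈ (U : Set X)ᶜ := fun hxU => hfx (Scheme.ord_of_isUnit hu hxU)
  rw [hCU] at hxU
  obtain ⟨W, hW, hxW⟩ := hxU
  have hwU : w W ∈ (U : Set X)ᶜ := by
    rw [hCU]
    exact ⟨W, hW, (hw W hW).mem⟩
  refine ⟨W, hW, ?_⟩
  have hwx : w W ⤳ x := (hw W hW).specializes hxW
  by_contra hne
  -- A point strictly below `w W`, which is itself strictly below the generic point of `X`, would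
  -- have coheight at least two.
  have hlt : x < w W := lt_of_le_not_ge hwx fun h => hne (Specializes.antisymm hwx h).eq
  have hgw : genericPoint X ⤳ w W := genericPoint_specializes _
  have hlt' : w W < genericPoint X := lt_of_le_not_ge hgw fun h => hwU <|
    Specializes.mem_open h U.isOpen
      (((genericPoint_spec X).mem_open_set_iff U.isOpen).2 (by simpa using hU))
  have h1 := Order.coheight_add_one_le hlt
  have h2 := Order.coheight_add_one_le hlt'
  have h3 : (1 : ℕ∞) + 1 ≤ 1 := by
    rw [hx] at h1
    exact (add_le_add_left ((le_add_left le_rfl).trans h2) 1).trans h1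
  exact absurd h3 (by decide)

end Orders

/-! ### Affine charts -/

section Charts

variable {k : Type u} [Field k]

/-- Sections over an open subset of a surface form a `k`-algebra. -/
instance sectionsAlgebra (S : Surface k) (U : S.scheme.Opens) : Algebra k Γ(S.scheme, U) :=
  ((Scheme.ΓSpecIso (CommRingCat.of k)).inv ≫ S.str.appTop ≫
    S.scheme.presheaf.map (homOfLE le_top).op).hom.toAlgebra

instance isScalarTower_sections_stalk (S : Surface k) (U : S.scheme.Opens) (x : U) :
    IsScalarTower k Γ(S.scheme, U) (S.scheme.presheaf.stalk (x : S.scheme)) :=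
  IsScalarTower.of_algebraMap_eq' <| congrArg CommRingCat.Hom.hom <| by
    change (Scheme.ΓSpecIso (CommRingCat.of k)).inv ≫ S.str.appTop ≫
      S.scheme.presheaf.germ ⊤ x.1 trivial = ((Scheme.ΓSpecIso (CommRingCat.of k)).inv ≫
      S.str.appTop ≫ S.scheme.presheaf.map (homOfLE le_top).op) ≫
      S.scheme.presheaf.germ U x.1 x.2
    simp

instance (S : Surface k) (x : S.scheme) :
    IsScalarTower k (localRing S x) (funField S) :=
  IsScalarTower.of_algebraMap_eq' <| congrArg CommRingCat.Hom.hom <|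
    congrArg (fun t => (Scheme.ΓSpecIso (CommRingCat.of k)).inv ≫ S.str.appTop ≫ t)
      (S.scheme.presheaf.germ_stalkSpecializes (U := ⊤) (y := x) trivial
        ((genericPoint_spec S.scheme).specializes trivial)).symm

instance (S : Surface k) (U : S.scheme.Opens) [Nonempty U] :
    IsScalarTower k Γ(S.scheme, U) (funField S) :=
  IsScalarTower.of_algebraMap_eq' <| congrArg CommRingCat.Hom.hom <| by
    change (Scheme.ΓSpecIso (CommRingCat.of k)).inv ≫ S.str.appTop ≫
      S.scheme.presheaf.germ ⊤ _ trivial = ((Scheme.ΓSpecIso (CommRingCat.of k)).inv ≫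
      S.str.appTop ≫ S.scheme.presheaf.map (homOfLE le_top).op) ≫
      S.scheme.presheaf.germ U _ _
    simp

/-- Every point of a surface has an affine neighbourhood whose ring is standard smooth. -/
lemma exists_isStandardSmooth (S : Surface k) (p : S.scheme) :
    ∃ V : S.scheme.Opens, IsAffineOpen V ∧ p ∈ V ∧
      Algebra.IsStandardSmoothOfRelativeDimension 2 k Γ(S.scheme, V) := by
  obtain ⟨U, -, V, hV, hp, e, h⟩ :=
    SmoothOfRelativeDimension.exists_isStandardSmoothOfRelativeDimension (n := 2) (f := S.str) p
  refine ⟨V, hV, hp, ?_⟩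
  -- `Spec k` has only one point, so the chart on the base is everything.
  have hU : U = ⊤ := by
    have : Subsingleton (Spec (CommRingCat.of k)) :=
      inferInstanceAs (Subsingleton (PrimeSpectrum k))
    rw [eq_top_iff]
    intro z _
    rw [Subsingleton.elim z (S.str p)]
    exact e hp
  subst hU
  have h2 := RingHom.IsStandardSmoothOfRelativeDimension.comp h
    (RingHom.IsStandardSmoothOfRelativeDimension.equiv
      (Scheme.ΓSpecIso (CommRingCat.of k)).symm.commRingCatIsoToRingEquiv)
  rw [← RingHom.isStandardSmoothOfRelativeDimension_algebraMap]
  exact h2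

/-- Smoothness enters through this normality, which a standard smooth chart passes on to its
localizations, and through the local coordinates below. -/
instance isIntegrallyClosed_stalk (S : Surface k) (p : S.scheme) :
    IsIntegrallyClosed (S.scheme.presheaf.stalk p) := by
  obtain ⟨V, hV, hp, h⟩ := exists_isStandardSmooth S p
  have : Nonempty V := ⟨⟨p, hp⟩⟩
  have : IsDomain Γ(S.scheme, V) := inferInstance
  have := isIntegrallyClosed_of_isStandardSmooth k Γ(S.scheme, V) 2
  let _ := TopCat.Presheaf.algebra_section_stalk S.scheme.presheaf (⟨p, hp⟩ : V)
  have hloc := hV.isLocalization_stalk ⟨p, hp⟩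
  exact isIntegrallyClosed_of_isLocalization (S.scheme.presheaf.stalk p) _
    (hV.primeIdealOf ⟨p, hp⟩).asIdeal.primeCompl_le_nonZeroDivisors

open KaehlerDifferential in
/-- A standard smooth algebra of relative dimension two has local coordinates. -/
lemma exists_basis_kaehlerDifferential (A : Type u) [CommRing A] [Algebra k A] [Nontrivial A]
    [Algebra.IsStandardSmoothOfRelativeDimension 2 k A] :
    ∃ (u v : A) (b : Module.Basis (Fin 2) A Ω[A⁄k]), b 0 = D k A u ∧ b 1 = D k A v := by
  obtain ⟨ι, σ, _, _, P, hP⟩ := ‹Algebra.IsStandardSmoothOfRelativeDimension 2 k A›.out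
  -- The differentials of the variables outside the range of `P.map` form a basis of the
  -- differentials; the relative dimension counts them.
  have hcard : Nat.card ((Set.range P.map)ᶜ : Set ι) = 2 := by
    have h1 := Algebra.IsStandardSmoothOfRelativeDimension.rank_kaehlerDifferential 2 (R := k) (S := A)
    rw [← Module.finrank_eq_nat_card_basis P.basisKaehler, Module.finrank, h1]
    simp
  let e : ((Set.range P.map)ᶜ : Set ι) ≃ Fin 2 := Nat.equivFinOfCardPos (by omega) |>.trans
    (finCongr hcard)
  refine ⟨P.val (e.symm 0), P.val (e.symm 1), P.basisKaehler.reindex e, ?_, ?_⟩ <;> simp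

end Charts

/-! ### Second exterior powers of vector spaces. -/

section Wedge

variable {K V : Type*} [Field K] [AddCommGroup V] [Module K V]

/-- The exterior product of two vectors. -/
def wedge (K : Type*) {V : Type*} [Field K] [AddCommGroup V] [Module K V] (a b : V) : ⋀[K]^2 V :=
  exteriorPower.ιMulti K 2 ![a, b]

lemma wedge_combination (e f : V) (a b c d : K) :
    wedge K (a • e + b • f) (c • e + d • f) = (a * d - b * c) • wedge K e f := by
  have hadd : ∀ x y z : V, wedge K (x + y) z = wedge K x z + wedge K y z := fun x y z => by
    simpa [wedge] using (exteriorPower.ιMulti K 2 (M := V)).map_vecCons_add ![z] x y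
  have hsmul : ∀ (r : K) (x z : V), wedge K (r • x) z = r • wedge K x z := fun r x z => by
    simpa [wedge] using (exteriorPower.ιMulti K 2 (M := V)).map_vecCons_smul ![z] r x
  have hself : ∀ x : V, wedge K x x = 0 := fun x =>
    (exteriorPower.ιMulti K 2 (M := V)).map_eq_zero_of_eq ![x, x] (i := 0) (j := 1) rfl (by decide)
  have hswap : ∀ x y : V, wedge K x y = - wedge K y x := fun x y => by
    have h := (exteriorPower.ιMulti K 2 (M := V)).map_swap ![y, x] (i := 0) (j := 1) (by decide)
    rw [wedge, wedge, ← h]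
    congr 1
    ext i
    fin_cases i <;> simp
  have hadd' : ∀ x y z : V, wedge K z (x + y) = wedge K z x + wedge K z y := fun x y z => by
    rw [hswap, hadd, neg_add, ← hswap, ← hswap]
  have hsmul' : ∀ (r : K) (x z : V), wedge K z (r • x) = r • wedge K z x := fun r x z => by
    rw [hswap, hsmul, hswap x z, smul_neg, neg_neg]
  rw [hadd, hadd', hadd', hsmul, hsmul, hsmul, hsmul, hsmul', hsmul', hsmul', hsmul', hself, hself,
    hswap f e]
  module

lemma exists_eq_smul_wedge {e f : V} (h : Submodule.span K {e, f} = ⊤) (ω : ⋀[K]^2 V) :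
    ∃ g : K, ω = g • wedge K e f := by
  have hω : ω ∈ Submodule.span K (Set.range (exteriorPower.ιMulti K 2 (M := V))) := by
    rw [exteriorPower.ιMulti_span]; trivial
  induction hω using Submodule.span_induction with
  | mem x hx =>
    obtain ⟨m, rfl⟩ := hx
    have h0 : ∀ i, m i ∈ Submodule.span K {e, f} := fun i => h ▸ trivial
    simp only [Submodule.mem_span_pair] at h0
    choose a b hab using h0
    refine ⟨a 0 * b 1 - b 0 * a 1, ?_⟩
    rw [← wedge_combination, hab, hab, wedge]
    congr 1
    ext i
    fin_cases i <;> rfl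
  | zero => exact ⟨0, by simp⟩
  | add x y _ _ hx hy =>
    obtain ⟨g, rfl⟩ := hx
    obtain ⟨g', rfl⟩ := hy
    exact ⟨g + g', by rw [add_smul]⟩
  | smul r x _ hx =>
    obtain ⟨g, rfl⟩ := hx
    exact ⟨r * g, by rw [mul_smul]⟩

/-- The determinant with respect to the basis is an alternating form taking the value `1` on it. -/
lemma wedge_basis_ne_zero (b : Module.Basis (Fin 2) K V) : wedge K (b 0) (b 1) ≠ 0 := by
  intro h
  have h1 := congrArg (exteriorPower.alternatingMapLinearEquiv b.det) h
  rw [wedge, exteriorPower.alternatingMapLinearEquiv_apply_ιMulti, LinearMap.map_zero] at h1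
  have h2 : (![b 0, b 1] : Fin 2 → V) = b := by
    ext i
    fin_cases i <;> rfl
  rw [h2, b.det_self] at h1
  exact one_ne_zero h1

end Wedge

/-! ### Rational two-forms and local coordinates. -/

section Forms

open KaehlerDifferential

variable {k : Type u} [Field k]

/-- The `2`-form `du ∧ dv`. -/
def form (k : Type u) [Field k] {K : Type u} [Field K] [Algebra k K] (u v : K) : ⋀[K]^2 (Ω[K⁄k]) :=
  wedge K (D k K u) (D k K v)

/-- The Jacobian determinant of a change of coordinates, formulated in such a way that it may be
transported along homomorphisms to fields. -/
lemma exists_jacobian {R : Type u} [CommRing R] [Algebra k R] {u v : R}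
    (h : Submodule.span R {D k R u, D k R v} = ⊤) (u' v' : R) :
    ∃ a : R, ∀ (K : Type u) [Field K] [Algebra k K] (φ : R →ₐ[k] K),
      form k (φ u') (φ v') = φ a • form k (φ u) (φ v) := by
  have h0 : ∀ w : Ω[R⁄k], ∃ a b : R, a • D k R u + b • D k R v = w := fun w =>
    Submodule.mem_span_pair.1 (h ▸ trivial)
  obtain ⟨a, b, hab⟩ := h0 (D k R u')
  obtain ⟨c, d, hcd⟩ := h0 (D k R v')
  refine ⟨a * d - b * c, fun K _ _ φ => ?_⟩
  let _ := φ.toRingHom.toAlgebra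
  have : IsScalarTower k R K := IsScalarTower.of_algebraMap_eq fun x => (φ.commutes x).symm
  have key : ∀ {w a b}, a • D k R u + b • D k R v = D k R w →
      D k K (φ w) = φ a • D k K (φ u) + φ b • D k K (φ v) := by
    intro w a b hw
    have h2 := congrArg (KaehlerDifferential.map k k R K) hw
    rw [map_add, map_smul, map_smul, map_D, map_D, map_D] at h2
    rw [← algebraMap_smul K a, ← algebraMap_smul K b] at h2
    exact h2.symm
  rw [form, key hab, key hcd, wedge_combination, form]
  simp

lemma span_D_eq_top_of_isLocalization {A B : Type u} [CommRing A] [Algebra k A] [CommRing B]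
    [Algebra k B] [Algebra A B] [IsScalarTower k A B] (M : Submonoid A) [IsLocalization M B]
    {u v : A} (h : Submodule.span A {D k A u, D k A v} = ⊤) :
    Submodule.span B {D k B (algebraMap A B u), D k B (algebraMap A B v)} = ⊤ := by
  have h2 := span_eq_top_of_isLocalizedModule B M (KaehlerDifferential.map k k A B) h
  rwa [Set.image_pair, map_D, map_D] at h2

/-- Around every point of a surface there are local coordinates. -/
lemma exists_coordinates (S : Surface k) (p : S.scheme) :
    ∃ (V : S.scheme.Opens) (u v : funField S), p ∈ V ∧ form k u v ≠ 0 ∧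
      ∀ x ∈ V, ∃ u' v' : localRing S x, algebraMap _ _ u' = u ∧ algebraMap _ _ v' = v ∧
        Submodule.span (localRing S x) {D k (localRing S x) u', D k (localRing S x) v'} = ⊤ := by
  obtain ⟨V, hV, hp, hsm⟩ := exists_isStandardSmooth S p
  have : Nonempty V := ⟨⟨p, hp⟩⟩
  obtain ⟨u, v, b, hu, hv⟩ := exists_basis_kaehlerDifferential (k := k) Γ(S.scheme, V)
  have hfr := functionField_isFractionRing_of_isAffineOpen S.scheme V hV
  have hspan : Submodule.span Γ(S.scheme, V) {D k Γ(S.scheme, V) u, D k Γ(S.scheme, V) v} = ⊤ := by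
    rw [← hu, ← hv, ← b.span_eq]
    congr 1
    ext z
    simp [Fin.exists_fin_two, eq_comm]
  refine ⟨V, algebraMap _ _ u, algebraMap _ _ v, hp, ?_, fun x hx => ?_⟩
  · let b' := b.ofIsLocalizedModule (funField S) (nonZeroDivisors Γ(S.scheme, V))
      (KaehlerDifferential.map k k Γ(S.scheme, V) (funField S))
    have h := wedge_basis_ne_zero b'
    simp only [b', Module.Basis.ofIsLocalizedModule_apply, hu, hv, map_D] at h
    exact h
  · let _ := TopCat.Presheaf.algebra_section_stalk S.scheme.presheaf (⟨x, hx⟩ : V)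
    have hloc := hV.isLocalization_stalk ⟨x, hx⟩
    have htower := functionField_isScalarTower S.scheme V ⟨x, hx⟩
    have htower' : IsScalarTower k Γ(S.scheme, V) (localRing S x) :=
      isScalarTower_sections_stalk S V ⟨x, hx⟩
    exact ⟨algebraMap _ _ u, algebraMap _ _ v,
      (IsScalarTower.algebraMap_apply _ _ _ _).symm, (IsScalarTower.algebraMap_apply _ _ _ _).symm,
      span_D_eq_top_of_isLocalization (hV.primeIdealOf ⟨x, hx⟩).asIdeal.primeCompl hspan⟩

end Forms

/-! ### Canonical divisors -/

section Canonical

open KaehlerDifferential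

variable {k : Type u} [Field k] {S : Surface k}

/-- The degree zero part of the polynomial ring is `k`, so the structure morphism is the proper
morphism from `Proj` to the spectrum of that part, followed by an isomorphism. -/
lemma projSpaceStr_isProper (k : Type u) [Field k] (n : ℕ) : IsProper (projSpaceStr k n) := by
  have hbij : Function.Bijective (algebraMap k (homGrading k n 0)) := by
    refine ⟨fun a b h => MvPolynomial.C_injective _ _ (congrArg Subtype.val h), fun x => ?_⟩
    obtain ⟨x, hx⟩ := x
    rw [MvPolynomial.mem_homogeneousSubmodule] at hx
    refine ⟨MvPolynomial.coeff 0 x, Subtype.ext ?_⟩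
    exact (MvPolynomial.totalDegree_eq_zero_iff_eq_C.1 (Nat.le_zero.1 hx.totalDegree_le)).symm
  have h1 : IsIso (Spec.map (CommRingCat.ofHom (algebraMap k (homGrading k n 0)))) := by
    have : IsIso (CommRingCat.ofHom (algebraMap k (homGrading k n 0))) :=
      (ConcreteCategory.isIso_iff_bijective _).2 hbij
    infer_instance
  have : IsScalarTower k (homGrading k n 0) (MvPolynomial (Fin (n + 1)) k) :=
    ⟨fun a b c => smul_mul_assoc a (b : MvPolynomial (Fin (n + 1)) k) c⟩
  have h2 : Algebra.FiniteType (homGrading k n 0) (MvPolynomial (Fin (n + 1)) k) :=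
    Algebra.FiniteType.of_restrictScalars_finiteType k _ _
  unfold projSpaceStr
  infer_instance

instance str_isProper (S : Surface k) : IsProper S.str := by
  obtain ⟨n, i, hi, h⟩ := S.projective
  have := projSpaceStr_isProper k n
  rw [← h]
  infer_instance

instance (S : Surface k) : CompactSpace S.scheme :=
  (quasiCompact_iff_compactSpace S.str).1 (inferInstanceAs (QuasiCompact S.str))

/-- The form `ω` has order `n` at the prime divisor `x`. -/
def HasOrder (ω : ⋀[funField S]^2 (Ω[funField S⁄k])) (x : PrimeDivisor S) (n : ℤ) : Prop :=
  ∃ (u v : localRing S x.1) (g : funField S),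
    Submodule.span (localRing S x.1) {D k (localRing S x.1) u, D k (localRing S x.1) v} = ⊤ ∧
    ω = g • form k (algebraMap (localRing S x.1) (funField S) u)
      (algebraMap (localRing S x.1) (funField S) v) ∧ n = Scheme.ord g x.1

lemma isCanonicalDivisor_iff {M : Div S} :
    IsCanonicalDivisor M ↔ ∃ ω : ⋀[funField S]^2 (Ω[funField S⁄k]), ω ≠ 0 ∧
      ∀ x, HasOrder ω x (M x) :=
  Iff.rfl

/-- Two systems of coordinates at `x` are related by Jacobians `a` and `a'` in the local ring with
`a' * a = 1`, so the coefficients of `ω` differ by a unit. -/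
lemma HasOrder.unique {ω : ⋀[funField S]^2 (Ω[funField S⁄k])} (hω : ω ≠ 0) {x : PrimeDivisor S}
    {n n' : ℤ} (h : HasOrder ω x n) (h' : HasOrder ω x n') : n = n' := by
  obtain ⟨u, v, g, hs, rfl, rfl⟩ := h
  obtain ⟨u', v', g', hs', hg, rfl⟩ := h'
  obtain ⟨a, ha⟩ := exists_jacobian hs u' v'
  obtain ⟨a', ha'⟩ := exists_jacobian hs' u v
  replace ha := ha _ (IsScalarTower.toAlgHom k (localRing S x.1) (funField S))
  replace ha' := ha' _ (IsScalarTower.toAlgHom k (localRing S x.1) (funField S))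
  simp only [IsScalarTower.coe_toAlgHom'] at ha ha'
  obtain ⟨hg0, hf0⟩ := smul_ne_zero_iff.1 hω
  rw [hg] at hω
  obtain ⟨hg0', hf0'⟩ := smul_ne_zero_iff.1 hω
  have hunit : a' * a = 1 := by
    rw [ha, smul_smul, ← map_mul] at ha'
    apply FaithfulSMul.algebraMap_injective (localRing S x.1) (funField S)
    rw [map_one]
    exact smul_left_injective _ hf0 (by simpa using ha'.symm)
  refine ord_eq_of_mul_isUnit hg0' (IsUnit.of_mul_eq_one_right _ hunit) ?_
  rw [ha, smul_smul] at hg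
  rw [mul_comm]
  exact smul_left_injective _ hf0 hg

/-- A rational form in terms of local coordinates. -/
lemma exists_local_expression {ω : ⋀[funField S]^2 (Ω[funField S⁄k])} (hω : ω ≠ 0)
    (p : S.scheme) :
    ∃ (V : S.scheme.Opens) (u v g : funField S), p ∈ V ∧ g ≠ 0 ∧ ω = g • form k u v ∧
      ∀ x ∈ V, ∃ u' v' : localRing S x, algebraMap _ _ u' = u ∧ algebraMap _ _ v' = v ∧
        Submodule.span (localRing S x) {D k (localRing S x) u', D k (localRing S x) v'} = ⊤ := by
  obtain ⟨V, u, v, hp, -, h⟩ := exists_coordinates S p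
  obtain ⟨u', v', rfl, rfl, hspan⟩ := h p hp
  obtain ⟨g, hg⟩ := exists_eq_smul_wedge
    (span_D_eq_top_of_isLocalization (B := funField S) (nonZeroDivisors (localRing S p)) hspan) ω
  exact ⟨V, _, _, g, hp, fun h0 => hω (by rw [hg, h0, zero_smul]), hg, h⟩

/-- On each `V p` the orders of `ω` are those of one function `g p`. Finitely many `V p` cover the
compact surface and each `g p` has finitely many zeros and poles, so the support is finite. -/
lemma exists_divisor_of_form {ω : ⋀[funField S]^2 (Ω[funField S⁄k])} (hω : ω ≠ 0) :
    ∃ M : Div S, ∀ x, HasOrder ω x (M x) := by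
  choose V u v g hpV hg hω' hco using exists_local_expression hω
  have hord : ∀ p (x : PrimeDivisor S), x.1 ∈ V p → HasOrder ω x (Scheme.ord (g p) x.1) := by
    intro p x hx
    obtain ⟨u', v', hu, hv, hs⟩ := hco p x.1 hx
    exact ⟨u', v', g p, hs, by rw [hu, hv]; exact hω' p, rfl⟩
  obtain ⟨t, ht⟩ := isCompact_univ.elim_finite_subcover (fun p => (V p : Set S.scheme))
    (fun p => (V p).isOpen) (fun p _ => Set.mem_iUnion.2 ⟨p, hpV p⟩)
  have hfin : (Function.support fun x : PrimeDivisor S => Scheme.ord (g x.1) x.1).Finite := by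
    refine Set.Finite.subset (t.finite_toSet.biUnion fun p _ =>
      (finite_ord_ne_zero (hg p)).preimage Subtype.val_injective.injOn) ?_
    intro x hx
    obtain ⟨p, hp, hxp⟩ := Set.mem_iUnion₂.1 (ht (Set.mem_univ x.1))
    refine Set.mem_biUnion hp ⟨x.2, ?_⟩
    rw [HasOrder.unique hω (hord p x hxp) (hord x.1 x (hpV x.1))]
    exact hx
  exact ⟨Finsupp.ofSupportFinite _ hfin, fun x => hord x.1 x (hpV x.1)⟩

lemma exists_isCanonicalDivisor (S : Surface k) : ∃ M : Div S, IsCanonicalDivisor M := by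
  obtain ⟨V, u, v, -, h, -⟩ := exists_coordinates S (genericPoint S.scheme)
  obtain ⟨M, hM⟩ := exists_divisor_of_form h
  exact ⟨M, _, h, hM⟩

lemma cls_eq_iff {M N : Div S} :
    cls M = cls N ↔ ∃ f : funField S, f ≠ 0 ∧ ∀ x, N x = Scheme.ord f x.1 + M x := by
  rw [cls, cls, QuotientAddGroup.eq]
  refine exists_congr fun f => and_congr_right fun _ => forall_congr' fun x => ?_
  rw [Finsupp.add_apply, Finsupp.neg_apply]
  constructor <;> intro h <;> linarith

lemma exists_eq_smul_of_ne_zero {ω : ⋀[funField S]^2 (Ω[funField S⁄k])} (hω : ω ≠ 0)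
    (ω' : ⋀[funField S]^2 (Ω[funField S⁄k])) : ∃ h : funField S, ω' = h • ω := by
  obtain ⟨V, u, v, hp, -, h⟩ := exists_coordinates S (genericPoint S.scheme)
  obtain ⟨u', v', rfl, rfl, hspan⟩ := h _ hp
  have hspan' := span_D_eq_top_of_isLocalization (B := funField S)
    (nonZeroDivisors (localRing S (genericPoint S.scheme))) hspan
  obtain ⟨g, rfl⟩ := exists_eq_smul_wedge hspan' ω
  obtain ⟨g', rfl⟩ := exists_eq_smul_wedge hspan' ω'
  have hg : g ≠ 0 := fun h0 => hω (by rw [h0, zero_smul])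
  exact ⟨g' / g, by rw [smul_smul, div_mul_cancel₀ _ hg]⟩

/-- Rational `2`-forms are a line over the function field, so two nonzero ones differ by a factor
`h` and their divisors by the divisor of `h`. -/
lemma IsCanonicalDivisor.cls_eq {M N : Div S} (hM : IsCanonicalDivisor M)
    (hN : IsCanonicalDivisor N) : cls M = cls N := by
  obtain ⟨ω, hω, hM⟩ := isCanonicalDivisor_iff.1 hM
  obtain ⟨ω', hω', hN⟩ := isCanonicalDivisor_iff.1 hN
  obtain ⟨h, rfl⟩ := exists_eq_smul_of_ne_zero hω ω'
  have hh : h ≠ 0 := fun h0 => hω' (by rw [h0, zero_smul])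
  refine cls_eq_iff.2 ⟨h, hh, fun x => ?_⟩
  obtain ⟨u, v, g, hs, rfl, hg⟩ := hM x
  have hg0 : g ≠ 0 := fun h0 => hω (by rw [h0, zero_smul])
  rw [hg, ← Scheme.ord_mul hh hg0]
  exact HasOrder.unique hω' (hN x) ⟨u, v, h * g, hs, by rw [mul_smul], rfl⟩

lemma IsCanonicalDivisor.cls_eq_canonicalClass {M : Div S} (hM : IsCanonicalDivisor M) :
    cls M = canonicalClass S := by
  have h := exists_isCanonicalDivisor S
  rw [canonicalClass, dif_pos h]
  exact hM.cls_eq h.choose_spec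

end Canonical

/-! ### The geometry of birational morphisms -/

lemma exists_lift_of_valuativeCriterion {X Y : Scheme.{u}} {f : X ⟶ Y}
    (hf : ValuativeCriterion.Existence f) (R K : CommRingCat.{u}) [IsDomain R] [ValuationRing R]
    (hK : IsField K) [Algebra R K] [IsFractionRing R K] (i₁ : Spec K ⟶ X) (i₂ : Spec R ⟶ Y)
    (comm : i₁ ≫ f = Spec.map (CommRingCat.ofHom (algebraMap R K)) ≫ i₂) :
    ∃ l : Spec R ⟶ X,
      Spec.map (CommRingCat.ofHom (algebraMap R K)) ≫ l = i₁ ∧ l ≫ f = i₂ := by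
  let := hK.toField
  obtain ⟨⟨l, hl₁, hl₂⟩⟩ := hf { R := R, K := K, i₁ := i₁, i₂ := i₂, commSq := ⟨comm⟩ }
  exact ⟨l, hl₁, hl₂⟩

section Birational

variable {k : Type u} [Field k] {S T : Surface k} {μ : S.scheme ⟶ T.scheme}

/-- The generic points lie in the dense open subschemes, where `μ` restricts to an open immersion.
-/
lemma IsBirationalMorphism.genericPoint_and_isIso (h : IsBirationalMorphism μ) :
    μ (genericPoint S.scheme) = genericPoint T.scheme ∧
      IsIso (μ.stalkMap (genericPoint S.scheme)) := by
  obtain ⟨-, e, he⟩ := h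
  have hne : Nonempty e.source := e.dense_source.nonempty.to_subtype
  have hgen : e.source.ι (genericPoint e.source) = genericPoint S.scheme :=
    genericPoint_eq_of_isOpenImmersion _
  have hgen' : (e.iso.hom ≫ e.target.ι) (genericPoint e.source) = genericPoint T.scheme :=
    genericPoint_eq_of_isOpenImmersion _
  rw [← hgen]
  refine ⟨?_, ?_⟩
  · rw [he] at hgen'
    exact hgen'
  · have h1 : IsOpenImmersion (e.source.ι ≫ μ) := he ▸ inferInstance
    have h2 : IsIso ((e.source.ι ≫ μ).stalkMap (genericPoint e.source)) := inferInstance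
    rw [Scheme.Hom.stalkMap_comp] at h2
    exact @IsIso.of_isIso_comp_right _ _ _ _ _ _ (e.source.ι.stalkMap (genericPoint e.source))
      inferInstance h2

/-- The homomorphism of function fields induced by a birational morphism. -/
def funFieldHom (h : IsBirationalMorphism μ) : funField T ⟶ funField S :=
  T.scheme.presheaf.stalkSpecializes (specializes_of_eq h.genericPoint_and_isIso.1) ≫
    μ.stalkMap (genericPoint S.scheme)

instance (h : IsBirationalMorphism μ) : IsIso (funFieldHom h) := by
  have := h.genericPoint_and_isIso.2
  have h2 : IsIso (T.scheme.presheaf.stalkSpecializes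
      (specializes_of_eq h.genericPoint_and_isIso.1)) :=
    (T.scheme.presheaf.stalkCongr (.of_eq h.genericPoint_and_isIso.1.symm)).isIso_hom
  unfold funFieldHom
  infer_instance

/-- The isomorphism of function fields induced by a birational morphism. -/
def funFieldEquiv (h : IsBirationalMorphism μ) : funField T ≃ₐ[k] funField S :=
  AlgEquiv.ofBijective
    { (funFieldHom h).hom with
      commutes' := fun r => by
        have key : ((Scheme.ΓSpecIso (CommRingCat.of k)).inv ≫ T.str.appTop ≫
            T.scheme.presheaf.germ ⊤ _ trivial) ≫ funFieldHom h =
            (Scheme.ΓSpecIso (CommRingCat.of k)).inv ≫ S.str.appTop ≫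
              S.scheme.presheaf.germ ⊤ (genericPoint S.scheme) trivial := by
          have h1 := T.scheme.presheaf.germ_stalkSpecializes (U := ⊤) (y := genericPoint T.scheme)
            trivial (specializes_of_eq h.genericPoint_and_isIso.1)
          have h2 := Scheme.Hom.germ_stalkMap μ ⊤ (genericPoint S.scheme) trivial
          have h3 : T.scheme.presheaf.germ ⊤ (genericPoint T.scheme) trivial ≫ funFieldHom h =
              μ.appTop ≫ S.scheme.presheaf.germ ⊤ (genericPoint S.scheme) trivial := by
            refine ((Category.assoc _ _ _).symm.trans (congrArg (· ≫ _) h1)).trans h2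
          have h4 : T.str.appTop ≫ μ.appTop = S.str.appTop := by
            rw [← h.1, Scheme.Hom.comp_appTop]
          rw [Category.assoc, Category.assoc, h3, ← h4, Category.assoc]
        exact congrArg (fun f => f.hom r) key }
    (ConcreteCategory.bijective_of_isIso (funFieldHom h))

/-- Pullback of rational functions extends pullback of germs; this turns statements on stalk maps
into statements inside the function fields. -/
lemma funFieldEquiv_algebraMap (h : IsBirationalMorphism μ) (x : S.scheme)
    (a : localRing T (μ x)) :
    funFieldEquiv h (algebraMap (localRing T (μ x)) (funField T) a) =
      algebraMap (localRing S x) (funField S) ((μ.stalkMap x).hom a) := by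
  have key : T.scheme.presheaf.stalkSpecializes
        ((genericPoint_spec T.scheme).specializes trivial) ≫ funFieldHom h =
      μ.stalkMap x ≫ S.scheme.presheaf.stalkSpecializes
        ((genericPoint_spec S.scheme).specializes trivial) := by
    rw [funFieldHom, TopCat.Presheaf.stalkSpecializes_comp_assoc]
    exact Scheme.Hom.stalkSpecializes_stalkMap μ _ _
      ((genericPoint_spec S.scheme).specializes trivial)
  exact congrArg (fun f => f.hom a) key

lemma IsBirationalMorphism.isProper (h : IsBirationalMorphism μ) : IsProper μ := by
  have : IsProper (μ ≫ T.str) := h.1 ▸ inferInstance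
  exact IsProper.of_comp μ T.str

/-- The stalk map of a morphism over `k`, as a homomorphism of `k`-algebras. -/
def stalkAlgHom (h : IsBirationalMorphism μ) (x : S.scheme) :
    localRing T (μ x) →ₐ[k] localRing S x where
  __ := (μ.stalkMap x).hom
  commutes' r := by
    apply FaithfulSMul.algebraMap_injective (localRing S x) (funField S)
    refine (funFieldEquiv_algebraMap h x _).symm.trans ?_
    rw [← IsScalarTower.algebraMap_apply, ← IsScalarTower.algebraMap_apply, AlgEquiv.commutes]

/-- By the valuative criterion, a prime divisor on the target of a birational morphism is the image
of a point whose local ring is contained in the local ring of the prime divisor. -/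
lemma IsBirationalMorphism.exists_lift (h : IsBirationalMorphism μ) (y : T.scheme)
    (hy : Order.coheight y = 1) :
    ∃ x : S.scheme, μ x = y ∧ ∀ s : localRing S x, ∃ r : localRing T y,
      funFieldEquiv h (algebraMap (localRing T y) (funField T) r) =
        algebraMap (localRing S x) (funField S) s := by
  have hdvr := isDiscreteValuationRing_stalk hy
  have hproper := h.isProper
  rw [IsProper.eq_valuativeCriterion] at hproper
  have hval := hproper.1.1.1.existence
  have hspec : ∀ x : S.scheme, genericPoint S.scheme ⤳ x := fun x =>
    (genericPoint_spec S.scheme).specializes trivial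
  have hspec' : genericPoint T.scheme ⤳ y := (genericPoint_spec T.scheme).specializes trivial
  -- The inverse of the isomorphism of function fields lifts the generic point of `T` to `S`.
  -- Properness extends the lift over the discrete valuation ring at `y`, and the closed point then
  -- goes to the required `x`.
  let i₁ : Spec (funField T) ⟶ S.scheme :=
    Spec.map (inv (funFieldHom h)) ≫ S.scheme.fromSpecStalk (genericPoint S.scheme)
  have hcomm : i₁ ≫ μ =
      Spec.map (T.scheme.presheaf.stalkSpecializes hspec') ≫ T.scheme.fromSpecStalk y := by
    have h1 : Spec.map (inv (funFieldHom h)) ≫ Spec.map (funFieldHom h) = 𝟙 _ := by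
      rw [← Spec.map_comp, IsIso.hom_inv_id, Spec.map_id]
    have h0 : Spec.map (funFieldHom h) = Spec.map (μ.stalkMap (genericPoint S.scheme)) ≫
        Spec.map (T.scheme.presheaf.stalkSpecializes
          (specializes_of_eq h.genericPoint_and_isIso.1)) := Spec.map_comp _ _
    rw [h0] at h1
    rw [Scheme.SpecMap_stalkSpecializes_fromSpecStalk, Category.assoc,
      ← Scheme.SpecMap_stalkMap_fromSpecStalk, ← Scheme.SpecMap_stalkSpecializes_fromSpecStalk
        (specializes_of_eq h.genericPoint_and_isIso.1)]
    simp only [← Category.assoc] at h1 ⊢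
    rw [h1, Category.id_comp]
  obtain ⟨l, hl₁, hl₂⟩ : ∃ l : Spec (localRing T y) ⟶ S.scheme,
      Spec.map (T.scheme.presheaf.stalkSpecializes hspec') ≫ l = i₁ ∧
        l ≫ μ = T.scheme.fromSpecStalk y :=
    exists_lift_of_valuativeCriterion hval (localRing T y) (funField T)
      (Field.toIsField (funField T)) i₁
      (T.scheme.fromSpecStalk y) hcomm
  let x : S.scheme := l (IsLocalRing.closedPoint (localRing T y))
  have hx : μ x = y := by
    have h1 : (l ≫ μ) (IsLocalRing.closedPoint (localRing T y)) = y := by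
      rw [hl₂, Scheme.fromSpecStalk_closedPoint]
    exact h1
  have hψ : Scheme.stalkClosedPointTo l ≫ T.scheme.presheaf.stalkSpecializes hspec' =
      S.scheme.presheaf.stalkSpecializes (hspec x) ≫ inv (funFieldHom h) := by
    apply Spec.map_injective
    rw [← cancel_mono (S.scheme.fromSpecStalk x), Spec.map_comp, Spec.map_comp, Category.assoc,
      Category.assoc, Scheme.SpecMap_stalkSpecializes_fromSpecStalk,
      Scheme.Spec_stalkClosedPointTo_fromSpecStalk, hl₁]
  refine ⟨x, hx, fun s => ⟨(Scheme.stalkClosedPointTo l).hom s, ?_⟩⟩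
  have h1 : (Scheme.stalkClosedPointTo l ≫ T.scheme.presheaf.stalkSpecializes hspec') ≫
      funFieldHom h = S.scheme.presheaf.stalkSpecializes (hspec x) := by
    rw [hψ, Category.assoc, IsIso.inv_hom_id, Category.comp_id]
  exact congrArg (fun f => f.hom s) h1

/-- Every prime divisor on the target of a birational morphism is the image of a prime divisor on
the source with the same local ring. -/
lemma IsBirationalMorphism.exists_primeDivisor (h : IsBirationalMorphism μ) (y : T.scheme)
    (hy : Order.coheight y = 1) :
    ∃ x : S.scheme, μ x = y ∧ Order.coheight x = 1 ∧ Function.Bijective (μ.stalkMap x).hom := by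
  obtain ⟨x, rfl, hlift⟩ := h.exists_lift y hy
  have hbij : Function.Bijective (μ.stalkMap x).hom := by
    refine ⟨fun a b hab => ?_, fun s => ?_⟩
    · apply FaithfulSMul.algebraMap_injective (localRing T (μ x)) (funField T)
      apply (funFieldEquiv h).injective
      rw [funFieldEquiv_algebraMap, funFieldEquiv_algebraMap, hab]
    · obtain ⟨r, hr⟩ := hlift s
      refine ⟨r, FaithfulSMul.algebraMap_injective (localRing S x) (funField S) ?_⟩
      rw [← hr, funFieldEquiv_algebraMap]
  refine ⟨x, rfl, ?_, hbij⟩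
  have h1 := ringKrullDim_eq_of_ringEquiv (RingEquiv.ofBijective _ hbij)
  rw [ringKrullDim_stalk_eq_coheight, ringKrullDim_stalk_eq_coheight, hy] at h1
  exact_mod_cast h1.symm

end Birational

/-! ### Invariants of linear systems -/

section LinearSystems

variable {k : Type u} [Field k] {S T : Surface k}

/-- The semilinear comparison map `f ↦ c * φ f` of function fields. -/
def scaleMap (φ : funField T ≃ₐ[k] funField S) (c : funField S) : funField T →ₗ[k] funField S :=
  LinearMap.mulLeft k c ∘ₗ φ.toLinearMap

@[simp]
lemma scaleMap_apply (φ : funField T ≃ₐ[k] funField S) (c : funField S) (f : funField T) :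
    scaleMap φ c f = c * φ f := rfl

lemma scaleMap_injective (φ : funField T ≃ₐ[k] funField S) {c : funField S} (hc : c ≠ 0) :
    Function.Injective (scaleMap φ c) := fun _ _ h =>
  φ.injective (mul_left_cancel₀ hc h)

/-- Letting the factors differ allows the induction to the powers `L ^ m`, scaled by `c ^ m`, from
which the Hilbert function is computed. -/
lemma map_scaleMap_mul (φ : funField T ≃ₐ[k] funField S) (c d : funField S)
    (L L' : Submodule k (funField T)) :
    (L * L').map (scaleMap φ (c * d)) = L.map (scaleMap φ c) * L'.map (scaleMap φ d) := by
  apply le_antisymm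
  · rw [Submodule.map_le_iff_le_comap, Submodule.mul_le]
    intro f hf g hg
    have : scaleMap φ (c * d) (f * g) = scaleMap φ c f * scaleMap φ d g := by
      simp only [scaleMap_apply, map_mul]; ring
    rw [Submodule.mem_comap, this]
    exact Submodule.mul_mem_mul (Submodule.mem_map_of_mem hf) (Submodule.mem_map_of_mem hg)
  · rw [Submodule.mul_le]
    rintro _ ⟨f, hf, rfl⟩ _ ⟨g, hg, rfl⟩
    refine ⟨f * g, Submodule.mul_mem_mul hf hg, ?_⟩
    simp only [scaleMap_apply, map_mul]; ring

lemma map_scaleMap_pow (φ : funField T ≃ₐ[k] funField S) (c : funField S)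
    (L : Submodule k (funField T)) (m : ℕ) :
    (L ^ m).map (scaleMap φ (c ^ m)) = L.map (scaleMap φ c) ^ m := by
  induction m with
  | zero =>
    have h : scaleMap φ (c ^ 0) = φ.toAlgHom.toLinearMap := by ext; simp
    rw [h, pow_zero, pow_zero, Submodule.map_one]
  | succ m ih => rw [pow_succ, pow_succ, pow_succ, map_scaleMap_mul, ih]

lemma finrank_map_scaleMap (φ : funField T ≃ₐ[k] funField S) {c : funField S} (hc : c ≠ 0)
    (L : Submodule k (funField T)) :
    Module.finrank k (L.map (scaleMap φ c)) = Module.finrank k L :=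
  (Submodule.equivMapOfInjective _ (scaleMap_injective φ hc) L).finrank_eq.symm

lemma hilbertFun_map_scaleMap (φ : funField T ≃ₐ[k] funField S) {c : funField S} (hc : c ≠ 0)
    (L : Submodule k (funField T)) : hilbertFun (L.map (scaleMap φ c)) = hilbertFun L := by
  funext m
  rw [hilbertFun, hilbertFun, ← map_scaleMap_pow, finrank_map_scaleMap φ (pow_ne_zero m hc)]

/-- The factor `c` cancels in quotients, so `φ` identifies the two image fields. -/
lemma imageDim_map_scaleMap (φ : funField T ≃ₐ[k] funField S) {c : funField S} (hc : c ≠ 0)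
    (L : Submodule k (funField T)) : imageDim (L.map (scaleMap φ c)) = imageDim L := by
  have h : imageField (L.map (scaleMap φ c)) = (imageField L).map φ.toAlgHom := by
    rw [imageField, imageField, IntermediateField.adjoin_map]
    congr 1
    ext h
    constructor
    · rintro ⟨_, ⟨f, hf, rfl⟩, _, ⟨g, hg, rfl⟩, hg0, rfl⟩
      refine ⟨f / g, ⟨f, hf, g, hg, fun h0 => hg0 (by simp [h0]), rfl⟩, ?_⟩
      simp only [scaleMap_apply, mul_div_mul_left _ _ hc]
      exact map_div₀ φ f g
    · rintro ⟨_, ⟨f, hf, g, hg, hg0, rfl⟩, rfl⟩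
      refine ⟨_, ⟨f, hf, rfl⟩, _, ⟨g, hg, rfl⟩, ?_, ?_⟩
      · simp [hc, hg0]
      · simp only [scaleMap_apply, mul_div_mul_left _ _ hc]
        exact map_div₀ φ f g
  rw [imageDim, imageDim, h]
  exact ((imageField L).equivMap φ.toAlgHom).trdeg_eq.symm

/-- The nonzero rational functions which are sections of the divisor `M`. -/
def sections (M : Div S) : Set (funField S) :=
  {f | f ≠ 0 ∧ ∀ x : PrimeDivisor S, 0 ≤ Scheme.ord f x.1 + M x}

lemma mul_mem_sections_iff {M N : Div S} {h : funField S} (hh : h ≠ 0)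
    (hMN : ∀ x, N x = Scheme.ord h x.1 + M x) (f : funField S) :
    h * f ∈ sections M ↔ f ∈ sections N := by
  by_cases hf : f = 0
  · simp [sections, hf]
  refine and_congr (by simp [hh]) (forall_congr' fun x => ?_)
  rw [hMN, Scheme.ord_mul hh hf, ← add_assoc, add_comm (Scheme.ord f x.1)]

lemma isEffective_cls_iff (M : Div S) : IsEffective (cls M) ↔ (sections M).Nonempty := by
  constructor
  · rintro ⟨N, hN, hNM⟩
    obtain ⟨f, hf, h⟩ := cls_eq_iff.1 hNM.symm
    exact ⟨f, hf, fun x => h x ▸ hN x⟩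
  · rintro ⟨f, hf, h⟩
    have hfin : (Function.support fun x : PrimeDivisor S => Scheme.ord f x.1 + M x).Finite := by
      refine (((finite_ord_ne_zero hf).preimage Subtype.val_injective.injOn).union
        M.hasFiniteSupport).subset fun x hx => ?_
      by_contra hn
      rw [Set.mem_union, not_or] at hn
      refine hx ?_
      have h1 : Scheme.ord f x.1 = 0 := by
        by_contra h1
        exact hn.1 ⟨x.2, h1⟩
      have h2 : M x = 0 := by simpa using hn.2
      simp [h1, h2]
    exact ⟨Finsupp.ofSupportFinite _ hfin, h, (cls_eq_iff.2 ⟨f, hf, fun x => rfl⟩).symm⟩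

/-- Two classes have the same complete linear system, up to an isomorphism of the function
fields. -/
def SameSystem (C : Pic S) (B : Pic T) : Prop :=
  ∃ (φ : funField T ≃ₐ[k] funField S) (N : Div S) (M : Div T), cls N = C ∧ cls M = B ∧
    ∀ f, f ∈ sections M ↔ φ f ∈ sections N

variable {C : Pic S} {B : Pic T}

lemma SameSystem.isEffective_iff (h : SameSystem C B) : IsEffective C ↔ IsEffective B := by
  obtain ⟨φ, N, M, rfl, rfl, h⟩ := h
  rw [isEffective_cls_iff, isEffective_cls_iff]
  constructor
  · rintro ⟨f, hf⟩
    exact ⟨φ.symm f, (h _).2 (by simpa using hf)⟩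
  · rintro ⟨f, hf⟩
    exact ⟨φ f, (h f).1 hf⟩

/-- `dim` and `nmc` use the chosen representatives. These differ from `N` and `M` by the divisors of
functions `a` and `b`, which twists `φ` by the factor `φ b / a`. -/
lemma SameSystem.exists_rrSpace_eq (h : SameSystem C B) :
    ∃ (φ : funField T ≃ₐ[k] funField S) (c : funField S), c ≠ 0 ∧
      rrSpace C.out = (rrSpace B.out).map (scaleMap φ c) := by
  obtain ⟨φ, N, M, hN, hM, h⟩ := h
  obtain ⟨a, ha, hNa⟩ := cls_eq_iff.1 (hN.trans (Quotient.out_eq' C).symm)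
  obtain ⟨b, hb, hMb⟩ := cls_eq_iff.1 (hM.trans (Quotient.out_eq' B).symm)
  have hφb : φ b ≠ 0 := by simpa using hb
  refine ⟨φ, φ b / a, div_ne_zero hφb ha, ?_⟩
  rw [rrSpace, rrSpace, Submodule.map_span]
  congr 1
  change sections C.out = scaleMap φ (φ b / a) '' sections B.out
  ext f
  rw [← mul_mem_sections_iff ha hNa]
  constructor
  · intro hf
    refine ⟨φ.symm (a * f) / b, ?_, ?_⟩
    · rw [← mul_mem_sections_iff hb hMb, mul_div_cancel₀ _ hb, h]
      simpa using hf
    · rw [scaleMap_apply, map_div₀, AlgEquiv.apply_symm_apply]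
      field_simp
  · rintro ⟨g, hg, rfl⟩
    rw [← mul_mem_sections_iff hb hMb, h, map_mul] at hg
    rwa [scaleMap_apply, ← mul_assoc, mul_div_cancel₀ _ ha]

lemma SameSystem.dim_eq (h : SameSystem C B) : dim C = dim B := by
  obtain ⟨φ, c, hc, h⟩ := h.exists_rrSpace_eq
  rw [dim, dim, h, finrank_map_scaleMap φ hc]

lemma SameSystem.nmc_eq (h : SameSystem C B) : nmc C = nmc B := by
  obtain ⟨φ, c, hc, h⟩ := h.exists_rrSpace_eq
  have hdeg : curveDegree (rrSpace C.out) = curveDegree (rrSpace B.out) := by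
    unfold curveDegree
    rw [h, hilbertFun_map_scaleMap φ hc]
  rw [nmc, nmc, hdeg, h, imageDim_map_scaleMap φ hc]

end LinearSystems

/-! ### Linear systems and birational morphisms -/

section Comparison

open KaehlerDifferential

variable {k : Type u} [Field k] {S T : Surface k} {μ : S.scheme ⟶ T.scheme}

lemma ord_pow' (x : S.scheme) {f : funField S} (hf : f ≠ 0) (n : ℕ) :
    Scheme.ord (f ^ n) x = n * Scheme.ord f x := by
  induction n with
  | zero => simp [ord_one']
  | succ n ih =>
    rw [pow_succ, Scheme.ord_mul (pow_ne_zero n hf) hf, ih]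
    push_cast
    ring

lemma ord_zpow' (x : S.scheme) {f : funField S} (hf : f ≠ 0) (n : ℤ) :
    Scheme.ord (f ^ n) x = n * Scheme.ord f x := by
  cases n with
  | ofNat n => simpa using ord_pow' x hf n
  | negSucc n =>
    rw [zpow_negSucc, ord_inv' S x (pow_ne_zero _ hf), ord_pow' x hf, Int.negSucc_eq]
    push_cast
    ring

lemma ord_unit_mul_irreducible_pow {x : S.scheme} (hx : Order.coheight x = 1)
    (u : (localRing S x)ˣ) {ϖ : localRing S x} (hϖ : Irreducible ϖ) (n : ℕ) :
    Scheme.ord (algebraMap (localRing S x) (funField S) (u * ϖ ^ n)) x = n := by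
  have := isDiscreteValuationRing_stalk hx
  have hϖ0 : algebraMap (localRing S x) (funField S) ϖ ≠ 0 := by simpa using hϖ.ne_zero
  have h1 : Scheme.ord (algebraMap (localRing S x) (funField S) ϖ) x = 1 := by
    rw [Scheme.ord_eq_iff hx hϖ0]
    exact Ring.ordFrac_irreducible hϖ
  rw [map_mul, map_pow, ord_eq_of_mul_isUnit (pow_ne_zero n hϖ0) u.isUnit rfl, ord_pow' x hϖ0, h1,
    mul_one]

/-- A birational morphism preserves the order of vanishing at a prime divisor where it induces an
isomorphism of local rings. -/
lemma ord_funFieldEquiv (h : IsBirationalMorphism μ) {x : S.scheme} (hx : Order.coheight x = 1)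
    (hy : Order.coheight (μ x) = 1) (hbij : Function.Bijective (μ.stalkMap x).hom)
    {f : funField T} (hf : f ≠ 0) :
    Scheme.ord (funFieldEquiv h f) x = Scheme.ord f (μ x) := by
  have := isDiscreteValuationRing_stalk hy
  let e := RingEquiv.ofBijective (μ.stalkMap x).hom hbij
  have key : ∀ a : localRing T (μ x), a ≠ 0 →
      Scheme.ord (funFieldEquiv h (algebraMap (localRing T (μ x)) (funField T) a)) x =
        Scheme.ord (algebraMap (localRing T (μ x)) (funField T) a) (μ x) := by
    intro a ha
    obtain ⟨ϖ, hϖ⟩ := IsDiscreteValuationRing.exists_irreducible (localRing T (μ x))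
    obtain ⟨n, u, rfl⟩ := IsDiscreteValuationRing.eq_unit_mul_pow_irreducible ha hϖ
    have hϖ' : Irreducible (e ϖ) := (MulEquiv.irreducible_iff e).2 hϖ
    rw [funFieldEquiv_algebraMap, ord_unit_mul_irreducible_pow hy u hϖ n,
      ← ord_unit_mul_irreducible_pow hx (u.map e.toMonoidHom) hϖ' n, map_mul, map_pow]
    rfl
  obtain ⟨a, b, hb, rfl⟩ := IsFractionRing.div_surjective (A := localRing T (μ x)) f
  have hb0 := nonZeroDivisors.ne_zero hb
  have ha0 : a ≠ 0 := by
    rintro rfl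
    simp at hf
  have ha1 : algebraMap (localRing T (μ x)) (funField T) a ≠ 0 := by simpa using ha0
  have hb1 : algebraMap (localRing T (μ x)) (funField T) b ≠ 0 := by simpa using hb0
  rw [map_div₀, div_eq_mul_inv, div_eq_mul_inv, Scheme.ord_mul ha1 (inv_ne_zero hb1),
    Scheme.ord_mul (by simpa using ha0) (by simpa using hb0), ord_inv' _ _ hb1,
    ord_inv' _ _ (by simpa using hb0), key a ha0, key b hb0]

/-- The pullback of rational `2`-forms along a birational morphism. -/
lemma exists_pullback_form (h : IsBirationalMorphism μ) {ω : ⋀[funField T]^2 (Ω[funField T⁄k])}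
    (hω : ω ≠ 0) :
    ∃ ω' : ⋀[funField S]^2 (Ω[funField S⁄k]), ω' ≠ 0 ∧ ∀ u v g : funField T,
      ω = g • form k u v → ω' = funFieldEquiv h g •
        form k (funFieldEquiv h u) (funFieldEquiv h v) := by
  obtain ⟨V, u₀, v₀, g₀, hp, hg₀, rfl, hco⟩ :=
    exists_local_expression hω (genericPoint T.scheme)
  have hspan' : ∀ x ∈ V, Submodule.span (funField T)
      {D k (funField T) u₀, D k (funField T) v₀} = ⊤ := by
    intro x hx
    obtain ⟨u₁, v₁, rfl, rfl, hspan⟩ := hco x hx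
    exact span_D_eq_top_of_isLocalization (nonZeroDivisors (localRing T x)) hspan
  replace hspan' := hspan' _ hp
  have hform : form k u₀ v₀ ≠ 0 := (smul_ne_zero_iff.1 hω).2
  refine ⟨funFieldEquiv h g₀ • form k (funFieldEquiv h u₀) (funFieldEquiv h v₀),
    smul_ne_zero (by simpa using hg₀) ?_, fun u v g hg => ?_⟩
  -- If the pulled back form vanished, so would the form of coordinates `u₂`, `v₂` on `S`, since
  -- both functions come from `T`.
  · intro h0
    obtain ⟨-, u₂, v₂, -, h2, -⟩ := exists_coordinates S (genericPoint S.scheme)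
    obtain ⟨a, ha⟩ := exists_jacobian hspan' ((funFieldEquiv h).symm u₂) ((funFieldEquiv h).symm v₂)
    have := ha (funField S) (funFieldEquiv h).toAlgHom
    refine h2 ?_
    simpa [h0] using this
  · obtain ⟨a, ha⟩ := exists_jacobian hspan' u v
    have h1 := ha (funField T) (AlgHom.id k _)
    have h2 := ha (funField S) (funFieldEquiv h).toAlgHom
    simp only [AlgHom.coe_id, id_eq] at h1
    rw [h1, smul_smul] at hg
    have h3 : g₀ = g * a := smul_left_injective _ hform hg
    rw [h3, map_mul, mul_smul]
    exact congrArg _ h2.symm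

/-- A canonical divisor on the source of a birational morphism contains the pullback of a canonical
divisor on the target, and coincides with it at the prime divisors which are not contracted. -/
lemma exists_canonicalDivisor_comparison (h : IsBirationalMorphism μ) {M : Div T}
    (hM : IsCanonicalDivisor M) :
    ∃ N : Div S, IsCanonicalDivisor N ∧
      (∀ x : PrimeDivisor S, ∃ (V : T.scheme.Opens) (g : funField T), μ x.1 ∈ V ∧ g ≠ 0 ∧
        (∀ y : PrimeDivisor T, y.1 ∈ V → M y = Scheme.ord g y.1) ∧
        Scheme.ord (funFieldEquiv h g) x.1 ≤ N x) ∧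
      ∀ (x : PrimeDivisor S) (hy : Order.coheight (μ x.1) = 1),
        Function.Bijective (μ.stalkMap x.1).hom → N x = M ⟨μ x.1, hy⟩ := by
  obtain ⟨ω, hω, hM⟩ := isCanonicalDivisor_iff.1 hM
  obtain ⟨ω', hω', hpull⟩ := exists_pullback_form h hω
  obtain ⟨N, hN⟩ := exists_divisor_of_form hω'
  refine ⟨N, ⟨ω', hω', hN⟩, fun x => ?_, fun x hy hbij => ?_⟩
  · obtain ⟨V, u, v, g, hp, hg, hωg, hco⟩ := exists_local_expression hω (μ x.1)
    refine ⟨V, g, hp, hg, fun y hy => ?_, ?_⟩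
    · obtain ⟨u', v', hu, hv, hs⟩ := hco y.1 hy
      exact (hM y).unique hω ⟨u', v', g, hs, by rw [hu, hv]; exact hωg, rfl⟩
    · obtain ⟨u', v', rfl, rfl, hs⟩ := hco _ hp
      obtain ⟨u₁, v₁, g₁, hs₁, hg₁, hNx⟩ := hN x
      have h1 := hpull _ _ _ hωg
      rw [funFieldEquiv_algebraMap, funFieldEquiv_algebraMap] at h1
      -- Coordinates at `μ x` pull back to functions regular at `x`. Their Jacobian `a` lies in the
      -- local ring and has nonnegative order; this is the excess of `N` over the pullback of `M`.
      obtain ⟨a, ha⟩ := exists_jacobian hs₁ ((μ.stalkMap x.1).hom u') ((μ.stalkMap x.1).hom v')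
      have h2 := ha _ (IsScalarTower.toAlgHom k (localRing S x.1) (funField S))
      simp only [IsScalarTower.coe_toAlgHom'] at h2
      rw [h2, smul_smul, hg₁] at h1
      rw [hg₁] at hω'
      have h3 := smul_left_injective _ (smul_ne_zero_iff.1 hω').2 h1
      have hg₁0 := (smul_ne_zero_iff.1 hω').1
      rw [h3] at hg₁0
      obtain ⟨h4, h5⟩ := mul_ne_zero_iff.1 hg₁0
      rw [hNx, h3, Scheme.ord_mul h4 h5]
      have := ord_algebraMap_nonneg (x := x.1) (a := a) (by rintro rfl; simp at h5)
      linarith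
  · obtain ⟨u, v, g, hs, hωg, hMx⟩ := hM ⟨μ x.1, hy⟩
    have hg : g ≠ 0 := by
      rintro rfl
      exact hω (by rw [hωg, zero_smul])
    rw [hMx, ← ord_funFieldEquiv h x.2 hy hbij hg]
    refine (hN x).unique hω' ⟨(μ.stalkMap x.1).hom u, (μ.stalkMap x.1).hom v, _, ?_, ?_, rfl⟩
    · let _ := (stalkAlgHom h x.1).toRingHom.toAlgebra
      have : IsScalarTower k (localRing T (μ x.1)) (localRing S x.1) :=
        IsScalarTower.of_algebraMap_eq fun r => ((stalkAlgHom h x.1).commutes r).symm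
      -- An isomorphism of local rings, viewed as a localization at the trivial submonoid, carries
      -- coordinates to coordinates.
      have hloc : IsLocalization (⊥ : Submonoid (localRing T (μ x.1))) (localRing S x.1) :=
        IsLocalization.of_le_isUnit_of_bijective (by
          rintro _ ⟨r, hr, rfl⟩
          rw [Submonoid.mem_bot.1 hr, map_one]
          exact isUnit_one) hbij
      exact span_D_eq_top_of_isLocalization (⊥ : Submonoid (localRing T (μ x.1))) hs
    · have h1 := hpull _ _ _ hωg
      rwa [funFieldEquiv_algebraMap, funFieldEquiv_algebraMap] at h1

lemma sections_pullback_iff (h : IsBirationalMorphism μ) {M : Div T} {N : Div S}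
    (hMN : IsPullback μ M N) {A : Div T} {B : Div S}
    (hAB : ∀ x : PrimeDivisor S, ∃ (V : T.scheme.Opens) (g : funField T), μ x.1 ∈ V ∧ g ≠ 0 ∧
        (∀ y : PrimeDivisor T, y.1 ∈ V → A y = Scheme.ord g y.1) ∧
        Scheme.ord (funFieldEquiv h g) x.1 ≤ B x)
    (hAB' : ∀ (x : PrimeDivisor S) (hy : Order.coheight (μ x.1) = 1),
        Function.Bijective (μ.stalkMap x.1).hom → B x = A ⟨μ x.1, hy⟩)
    (q : ℤ) {p : ℤ} (hp : 0 ≤ p) (f : funField T) :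
    f ∈ sections (q • M + p • A) ↔ funFieldEquiv h f ∈ sections (q • N + p • B) := by
  by_cases hf : f = 0
  · simp [sections, hf]
  refine and_congr (by simp) ⟨fun H x => ?_, fun H y => ?_⟩
  · obtain ⟨a, b, U, ha, hb, hxU, hMU, hNx⟩ := hMN x
    obtain ⟨V, g, hxV, hg, hAV, hgB⟩ := hAB x
    have ha1 : algebraMap (localRing T (μ x.1)) (funField T) a ≠ 0 := by simpa using ha
    have hb1 : algebraMap (localRing T (μ x.1)) (funField T) b ≠ 0 := by simpa using hb
    set a' := algebraMap (localRing T (μ x.1)) (funField T) a with ha'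
    set b' := algebraMap (localRing T (μ x.1)) (funField T) b with hb'
    have hab : a' * b'⁻¹ ≠ 0 := mul_ne_zero ha1 (inv_ne_zero hb1)
    have hab2 := zpow_ne_zero q hab
    have hg2 := zpow_ne_zero p hg
    have hF : f * (a' * b'⁻¹) ^ q * g ^ p ≠ 0 := mul_ne_zero (mul_ne_zero hf hab2) hg2
    -- `F` is `f` times a local equation of `q M + p A` at `μ x`; prime divisors through `μ x` lie
    -- in both `U` and `V`, where the equations are valid.
    obtain ⟨F, hF'⟩ := mem_range_of_forall_ord_nonneg (p := μ x.1) hF fun y hy hyx => by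
      have h1 := H ⟨y, hy⟩
      have hyU := hyx.mem_open U.isOpen hxU
      have hyV := hyx.mem_open V.isOpen hxV
      rw [Scheme.ord_mul (mul_ne_zero hf hab2) hg2, Scheme.ord_mul hf hab2, ord_zpow' _ hab,
        ord_zpow' _ hg, Scheme.ord_mul ha1 (inv_ne_zero hb1), ord_inv' _ _ hb1]
      simp only [Finsupp.add_apply, Finsupp.smul_apply, smul_eq_mul] at h1
      rw [hMU ⟨y, hy⟩ hyU, hAV ⟨y, hy⟩ hyV] at h1
      linarith
    have hF0 : (μ.stalkMap x.1).hom F ≠ 0 := by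
      intro h0
      have h1 := funFieldEquiv_algebraMap h x.1 F
      rw [h0, map_zero, hF', map_eq_zero_iff _ (funFieldEquiv h).injective] at h1
      exact hF h1
    have h2 := ord_algebraMap_nonneg hF0
    rw [← funFieldEquiv_algebraMap h, hF', map_mul, map_mul, map_zpow₀, map_zpow₀, map_mul,
      map_inv₀] at h2
    have e1 : ∀ {z : funField T}, z ≠ 0 → funFieldEquiv h z ≠ 0 := fun hz => by simpa using hz
    have e2 : funFieldEquiv h a' * (funFieldEquiv h b')⁻¹ ≠ 0 :=
      mul_ne_zero (e1 ha1) (inv_ne_zero (e1 hb1))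
    rw [Scheme.ord_mul (mul_ne_zero (e1 hf) (zpow_ne_zero q e2)) (zpow_ne_zero p (e1 hg)),
      Scheme.ord_mul (e1 hf) (zpow_ne_zero q e2), ord_zpow' _ e2, ord_zpow' _ (e1 hg),
      Scheme.ord_mul (e1 ha1) (inv_ne_zero (e1 hb1)), ord_inv' _ _ (e1 hb1)] at h2
    rw [← funFieldEquiv_algebraMap h, ← funFieldEquiv_algebraMap h, ← ha', ← hb'] at hNx
    simp only [Finsupp.add_apply, Finsupp.smul_apply, smul_eq_mul]
    rw [hNx]
    -- For `p ≥ 0` the excess of `B` over the pullback of `A` counts in favour of the section.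
    have h3 := mul_le_mul_of_nonneg_left hgB hp
    linarith
  · obtain ⟨y, hy⟩ := y
    -- At such an `x` all orders agree with those at `y`, so the condition at `x` is the condition
    -- at `y`.
    obtain ⟨x, rfl, hx, hbij⟩ := h.exists_primeDivisor y hy
    have h1 := H ⟨x, hx⟩
    obtain ⟨a, b, U, ha, hb, hxU, hMU, hNx⟩ := hMN ⟨x, hx⟩
    rw [← funFieldEquiv_algebraMap h, ← funFieldEquiv_algebraMap h,
      ord_funFieldEquiv h hx hy hbij (by simpa using ha),
      ord_funFieldEquiv h hx hy hbij (by simpa using hb)] at hNx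
    simp only [Finsupp.add_apply, Finsupp.smul_apply, smul_eq_mul] at h1 ⊢
    rw [ord_funFieldEquiv h hx hy hbij hf, hNx, hAB' ⟨x, hx⟩ hy hbij] at h1
    rw [hMU ⟨μ x, hy⟩ hxU]
    exact h1

/-- The adjoint systems of a class and of its pullback along a birational morphism coincide. -/
lemma sameSystem_adj (h : IsBirationalMorphism μ) {B : Pic T} {C : Pic S}
    (hBC : IsPullbackClass μ B C) (q : ℤ) {p : ℤ} (hp : 0 ≤ p) :
    SameSystem (adj C q p) (adj B q p) := by
  obtain ⟨M, N, rfl, rfl, hMN⟩ := hBC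
  obtain ⟨A, hA⟩ := exists_isCanonicalDivisor T
  obtain ⟨A', hA', h1, h2⟩ := exists_canonicalDivisor_comparison h hA
  refine ⟨funFieldEquiv h, q • N + p • A', q • M + p • A, ?_, ?_,
    fun f => sections_pullback_iff h hMN h1 h2 q hp f⟩
  · rw [adj, ← hA'.cls_eq_canonicalClass]; rfl
  · rw [adj, ← hA.cls_eq_canonicalClass]; rfl

end Comparison

/-! ### Level and keel along an adjoint chain -/

section Chain

variable {k : Type u} [Field k]

lemma adj_one_zero {S : Surface k} (C : Pic S) : adj C 1 0 = C := by
  simp [adj]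

lemma adj_add_canonicalClass {S : Surface k} (C : Pic S) (q p : ℤ) :
    adj (C + canonicalClass S) q p = adj C q (p + q) := by
  rw [adj, adj, zsmul_add, add_zsmul]
  abel

/-- The adjoint systems `q D + p K` and `q E + (p - q n) K` behave alike. -/
def AdjointShift {S T : Surface k} (D : Pic S) (E : Pic T) (n : ℕ) : Prop :=
  ∀ p q : ℤ, 0 ≤ q → q * n ≤ p →
    (IsEffective (adj D q p) ↔ IsEffective (adj E q (p - q * n))) ∧
    dim (adj D q p) = dim (adj E q (p - q * n)) ∧
    nmc (adj D q p) = nmc (adj E q (p - q * n))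

section Shift

variable {S T : Surface k} {D : Pic S} {E : Pic T} {n : ℕ}

lemma AdjointShift.coe_le_level (h : AdjointShift D E n) (hE : IsEffective E) :
    ((n : ℝ) : EReal) ≤ level D := by
  refine le_sSup ⟨n, 1, one_pos, ?_, by simp⟩
  rw [(h n 1 zero_le_one (by simp)).1]
  simpa [adj_one_zero] using hE

lemma zero_le_level (hE : IsEffective E) : 0 ≤ level E :=
  le_sSup ⟨0, 1, one_pos, by rwa [adj_one_zero], by simp⟩

lemma shift_div {p q n : ℝ} (hq : 0 < q) : (p - q * n) / q = p / q - n := by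
  field_simp

/-- The shift moves each quotient `p / q` by `n`. Quotients outside its range, below `n` for `D` or
below `0` for `E`, do not affect the suprema, because `E` effective gives `n ≤ level D` and `0 ≤
level E`. -/
lemma AdjointShift.level_eq (h : AdjointShift D E n) (hE : IsEffective E) :
    level E = level D - ((n : ℝ) : EReal) := by
  apply le_antisymm
  · refine sSup_le ?_
    rintro _ ⟨p, q, hq, hpq, rfl⟩
    have hq' : (0 : ℝ) < q := by exact_mod_cast hq
    rw [EReal.le_sub_iff_add_le (.inl (EReal.coe_ne_bot _)) (.inl (EReal.coe_ne_top _)), ← EReal.coe_add]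
    rcases le_or_gt 0 p with hp | hp
    · refine le_sSup ⟨p + q * n, q, hq, ?_, ?_⟩
      · rw [(h _ _ hq.le (by linarith)).1]
        simpa using hpq
      · congr 1
        push_cast
        field_simp
    · refine le_trans ?_ (h.coe_le_level hE)
      have : (p : ℝ) / q ≤ 0 := div_nonpos_of_nonpos_of_nonneg (by exact_mod_cast hp.le) hq'.le
      exact_mod_cast (by linarith : (p : ℝ) / q + n ≤ n)
  · rw [EReal.sub_le_iff_le_add (.inl (EReal.coe_ne_bot _)) (.inl (EReal.coe_ne_top _))]
    refine sSup_le ?_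
    rintro _ ⟨p, q, hq, hpq, rfl⟩
    have hq' : (0 : ℝ) < q := by exact_mod_cast hq
    rw [← EReal.sub_le_iff_le_add (.inl (EReal.coe_ne_bot _)) (.inl (EReal.coe_ne_top _)), ← EReal.coe_sub]
    rcases le_or_gt (q * n) p with hp | hp
    · refine le_sSup ⟨p - q * n, q, hq, (h _ _ hq.le hp).1.1 hpq, ?_⟩
      rw [Int.cast_sub, Int.cast_mul, Int.cast_natCast, shift_div hq']
    · refine le_trans ?_ (zero_le_level hE)
      have : (p : ℝ) / q ≤ n := by
        rw [div_le_iff₀ hq', mul_comm]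
        exact_mod_cast hp.le
      exact_mod_cast (by linarith : (p : ℝ) / q - n ≤ 0)

lemma AdjointShift.le_of_attainsLevel (h : AdjointShift D E n) (hE : IsEffective E) {p q : ℤ}
    (hpq : AttainsLevel D p q) : q * n ≤ p := by
  have h1 := h.coe_le_level hE
  have hq' : (0 : ℝ) < q := by exact_mod_cast hpq.1
  rw [← hpq.2.2, EReal.coe_le_coe_iff, le_div_iff₀ hq', mul_comm] at h1
  exact_mod_cast h1

lemma AdjointShift.attainsLevel_iff (h : AdjointShift D E n) (hE : IsEffective E) {p q : ℤ}
    (hp : q * n ≤ p) : AttainsLevel D p q ↔ AttainsLevel E (p - q * n) q := by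
  refine and_congr_right fun hq => and_congr (h _ _ hq.le hp).1 ?_
  have hq' : (0 : ℝ) < q := by exact_mod_cast hq
  rw [h.level_eq hE]
  rw [Int.cast_sub, Int.cast_mul, Int.cast_natCast, shift_div hq', EReal.coe_sub]
  refine ⟨fun h => by rw [h], fun h => ?_⟩
  have := congrArg (· + ((n : ℝ) : EReal)) h
  simpa only [EReal.sub_add_cancel] using this

/-- Pairs attaining the level lie in the range of the shift. With `P` arbitrary, one equivalence
serves both the attainment test and the supremum in `keel`. -/
lemma AdjointShift.exists_attainsLevel_iff (h : AdjointShift D E n) (hE : IsEffective E)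
    (P : ℕ → ℤ → Prop) :
    (∃ p q : ℤ, AttainsLevel D p q ∧ P (nmc (adj D q p)) q) ↔
      ∃ p q : ℤ, AttainsLevel E p q ∧ P (nmc (adj E q p)) q := by
  constructor
  · rintro ⟨p, q, hpq, hP⟩
    have hp := h.le_of_attainsLevel hE hpq
    exact ⟨p - q * n, q, (h.attainsLevel_iff hE hp).1 hpq, by rwa [← (h _ _ hpq.1.le hp).2.2]⟩
  · rintro ⟨p, q, hpq, hP⟩
    have hp : 0 ≤ p := by
      have h1 := zero_le_level hE
      have hq' : (0 : ℝ) < q := by exact_mod_cast hpq.1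
      rw [← hpq.2.2, ← EReal.coe_zero, EReal.coe_le_coe_iff, le_div_iff₀ hq', zero_mul] at h1
      exact_mod_cast h1
    have hp' : q * n ≤ p + q * n := by linarith
    refine ⟨p + q * n, q, (h.attainsLevel_iff hE hp').2 (by simpa using hpq), ?_⟩
    rw [(h _ _ hpq.1.le hp').2.2]
    simpa using hP

lemma AdjointShift.keel_eq (h : AdjointShift D E n) (hE : IsEffective E) : keel E = keel D := by
  have h1 := h.exists_attainsLevel_iff hE fun _ _ => True
  simp only [and_true] at h1
  have h2 (r : EReal) := h.exists_attainsLevel_iff hE fun m q => r = ((m / q : ℝ) : EReal)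
  classical exact if_congr h1.symm (by simp only [h2]) rfl

end Shift

lemma AdjointChain.isEffective_and_adjointShift {S : Surface k} {D : Pic S}
    (hD : IsEffective D) (C : AdjointChain S D) (i : ℕ) (hi : (i : ℕ∞) ≤ C.length) :
    IsEffective (C.div i) ∧ AdjointShift D (C.div i) i := by
  induction i with
  | zero =>
    have key := sameSystem_adj C.minimalization₀.birational C.minimalization₀.pullback_push
    rw [← C.div_zero] at key
    refine ⟨?_, fun p q hq hp => ?_⟩
    · simpa [adj_one_zero] using (key 1 le_rfl).isEffective_iff.1 (by rwa [adj_one_zero])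
    · have h := key q (p := p) (by simpa using hp)
      simpa using ⟨h.isEffective_iff, h.dim_eq, h.nmc_eq⟩
  | succ i ih =>
    have hi' : (i : ℕ∞) < C.length :=
      lt_of_lt_of_le (by exact_mod_cast Nat.lt_succ_self i) hi
    obtain ⟨-, hs⟩ := ih hi'.le
    have key := sameSystem_adj (C.minimalization i hi').birational
      (C.minimalization i hi').pullback_push
    rw [← C.div_succ i hi'] at key
    refine ⟨?_, fun p q hq hp => ?_⟩
    · have := (key 1 le_rfl).isEffective_iff.1 (by rw [adj_one_zero]; exact C.effective i hi')
      rwa [adj_one_zero] at this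
    · push_cast at hp ⊢
      -- The bound `q (i + 1) ≤ p` says that this multiple of `K` is nonnegative, as the comparison
      -- requires. Absorbing `q K` from `q (Dᵢ + Kᵢ)` leaves the coefficient `p - q i` of the
      -- previous stage.
      have h := key q (p := p - q * (i + 1)) (by linarith)
      rw [adj_add_canonicalClass, show p - q * ((i : ℤ) + 1) + q = p - q * i by ring] at h
      obtain ⟨h1, h2, h3⟩ := hs p q hq (by linarith)
      exact ⟨h1.trans h.isEffective_iff, h2.trans h.dim_eq, h3.trans h.nmc_eq⟩

end Chain

end SurfaceAdjunction

end

theorem mainTheorem7 {k : Type u} [Field k] [PerfectField k]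
    (S : SurfaceAdjunction.Surface k) (hS : S.IsRational)
    (D : SurfaceAdjunction.Pic S) (hnef : SurfaceAdjunction.IsNef D)
    (hpos : 0 < SurfaceAdjunction.inter D D) (heff : SurfaceAdjunction.IsEffective D)
    (C : SurfaceAdjunction.AdjointChain S D) (i : ℕ) (hi : (i : ℕ∞) ≤ C.length) :
    SurfaceAdjunction.IsEffective (C.div i) ∧
    SurfaceAdjunction.level (C.div i) = SurfaceAdjunction.level D - (i : EReal) ∧
    SurfaceAdjunction.keel (C.div i) = SurfaceAdjunction.keel D ∧
    ∀ p q : ℤ, 0 ≤ q → q * i ≤ p →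
      SurfaceAdjunction.dim (SurfaceAdjunction.adj D q p) =
        SurfaceAdjunction.dim (SurfaceAdjunction.adj (C.div i) q (p - q * i)) ∧
      SurfaceAdjunction.nmc (SurfaceAdjunction.adj D q p) =
        SurfaceAdjunction.nmc (SurfaceAdjunction.adj (C.div i) q (p - q * i)) := by
  obtain ⟨hE, h⟩ := C.isEffective_and_adjointShift heff i hi
  refine ⟨hE, ?_, h.keel_eq hE, fun p q hq hp => (h p q hq hp).2⟩
  rw [h.level_eq hE]
  norm_cast
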